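/- Let $p>1$ be real, $r\ge 1$ an integer and $c=\{c_{jk}\}_{j,k\ge 1}$ a double sequence of complex numbers. Write $\Delta_{r0}c_{jk}=c_{jk}-c_{j+r,k}$, $\Delta_{0r}c_{jk}=c_{jk}-c_{j,k+r}$ and $\Delta_{rr}c_{jk}=\Delta_{r0}(\Delta_{0r}c_{jk})$. For an integer $\lambda\ge 2$ and sequences $b_1,b_2,b_3$ of positive reals tending (not necessarily monotonically) to infinity put, with $M,N$ ranging over positive integers, $$ {}_2\alpha_{mn}=\frac1m\max_{b_1(m)\le M\le\lambda b_1(m)}\sum_{j=M}^{2M}|c_{jn}|,\qquad {}_2\beta_{mn}=\frac1n\max_{b_2(n)\le N\le\lambda b_2(n)}\sum_{k=N}^{2N}|c_{mk}|,\qquad {}_2\gamma_{mn}=\frac1{mn}\sup_{M+N\ge b_3(m+n)}\sum_{j=M}^{2M}\sum_{k=N}^{2N}|c_{jk}| $$ (a maximum over the empty set is $0$). We say that $c\in DGM(p,{}_2\alpha,{}_2\beta,{}_2\gamma,r)$ if for some such $\lambda,b_1,b_2,b_3$ (which may depend on $c$) there are a constant $C>0$ and an integer $\lambda'\ge1$ such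 that $$\Big(\sum_{j=m}^{2m-1}|\Delta_{r0}c_{jn}|^p\Big)^{1/p}\le C\,{}_2\alpha_{mn}\quad(m\ge\lambda',\,n\ge1),\qquad \Big(\sum_{k=n}^{2n-1}|\Delta_{0r}c_{mk}|^p\Big)^{1/p}\le C\,{}_2\beta_{mn}\quad(m\ge1,\,n\ge\lambda'),$$ $$\Big(\sum_{j=m}^{2m-1}\sum_{k=n}^{2n-1}|\Delta_{rr}c_{jk}|^p\Big)^{1/p}\le C\,{}_2\gamma_{mn}\quad(m,n\ge\lambda').$$ A double series $\sum_{j,k\ge1}a_{jk}$ is regularly convergent if $\sum_{j=1}^m\sum_{k=1}^n a_{jk}$ converges to a finite limit as $m,n\to\infty$ independently and all the series $\sum_{j\ge1}a_{jn}$ ($n\ge1$) and $\sum_{k\ge1}a_{mk}$ ($m\ge1$) converge. A double series of functions is uniformly regularly convergent if all these convergences are uniform. Theorem. Let $c\in DGM(p,{}_2\alpha,{}_2\beta,{}_2\gamma,r)$. Assume that (i) if $r\ge3$, the series $\sum_{j=1}^\infty\sum_{k=1}^\infty c_{jk}\sin\left(\frac{2l_1\pi}{r}j\right)\sin\left(\frac{2l_2\pi}{r}k\right)$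 is regularly convergent for all $l_1,l_2\in\{1,\dots,\frac r2-1\}$ when $r$ is even, and for all $l_1,l_2\in\{1,\dots,\frac{r-1}2\}$ when $r$ is odd; (ii) as $m+n\to\infty$ ($m,n\ge1$), $$\sup_{j\ge m}\,j\ln j\sum_{k=n}^\infty|c_{jk}|\to0\quad\text{and}\quad \sup_{k\ge n}\,k\ln k\sum_{j=m}^\infty|c_{jk}|\to0,$$ where for $j=1$ (respectively $k=1$) the expression is $0$ because $\ln 1=0$, even if the sum is infinite; (iii) $mn\ln m\ln n\,|c_{mn}|\to0$ as $m+n\to\infty$ ($m,n\ge1$). Then the double sine series $\sum_{j=1}^\infty\sum_{k=1}^\infty c_{jk}\sin jx\,\sin ky$ is uniformly regularly convergent in $(x,y)\in\mathbb R^2$. -/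

import Mathlib

open Filter Topology
open scoped ENNReal

/-!  Double sequences `{c_{jk}}` are functions `c : ℕ → ℕ → ℂ`.  All notions below only look at the
entries `c j k` with `j, k ≥ 1`. -/

/-- `Δ_{r0} c_{jk} = c_{jk} - c_{j+r,k}`. -/
def deltaRow (r : ℕ) (c : ℕ → ℕ → ℂ) (j k : ℕ) : ℂ := c j k - c (j + r) k

/-- `Δ_{0r} c_{jk} = c_{jk} - c_{j,k+r}`. -/
def deltaCol (r : ℕ) (c : ℕ → ℕ → ℂ) (j k : ℕ) : ℂ := c j k - c j (k + r)

/-- `Δ_{rr} c_{jk} = Δ_{r0} (Δ_{0r} c_{jk})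
  = c_{jk} - c_{j+r,k} - c_{j,k+r} + c_{j+r,k+r}`. -/
def deltaBoth (r : ℕ) (c : ℕ → ℕ → ℂ) (j k : ℕ) : ℂ := deltaRow r (deltaCol r c) j k

/-- The class `DGM(p, α, β, γ, r)` of double sequences, for nonnegative (extended real valued)
double sequences `α`, `β`, `γ`. -/
def DGM (p : ℝ) (α β γ : ℕ → ℕ → ℝ≥0∞) (r : ℕ) : Set (ℕ → ℕ → ℂ) :=
  {c | ∃ C : ℝ, 0 < C ∧ ∃ lam : ℕ, 1 ≤ lam ∧
    (∀ m n : ℕ, lam ≤ m → 1 ≤ n →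
      (∑ j ∈ Finset.Ico m (2 * m), ‖deltaRow r c j n‖ₑ ^ p) ^ (1 / p)
        ≤ ENNReal.ofReal C * α m n) ∧
    (∀ m n : ℕ, 1 ≤ m → lam ≤ n →
      (∑ k ∈ Finset.Ico n (2 * n), ‖deltaCol r c m k‖ₑ ^ p) ^ (1 / p)
        ≤ ENNReal.ofReal C * β m n) ∧
    (∀ m n : ℕ, lam ≤ m → lam ≤ n →
      (∑ j ∈ Finset.Ico m (2 * m), ∑ k ∈ Finset.Ico n (2 * n), ‖deltaBoth r c j k‖ₑ ^ p) ^ (1 / p)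
        ≤ ENNReal.ofReal C * γ m n)}

/-- `₂α_{mn} = (1/m) max_{b(m) ≤ M ≤ λ b(m)} ∑_{j=M}^{2M} |c_{jn}|`, with `M` a positive integer. -/
noncomputable def alphaTwo (c : ℕ → ℕ → ℂ) (lam : ℕ) (b : ℕ → ℝ) (m n : ℕ) : ℝ≥0∞ :=
  (m : ℝ≥0∞)⁻¹ * ⨆ (M : ℕ) (_ : 1 ≤ M ∧ b m ≤ M ∧ (M : ℝ) ≤ lam * b m),
    ∑ j ∈ Finset.Icc M (2 * M), ‖c j n‖ₑ

/-- `₂β_{mn} = (1/n) max_{b(n) ≤ N ≤ λ b(n)} ∑_{k=N}^{2N} |c_{mk}|`, with `N` a positive integer. -/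
noncomputable def betaTwo (c : ℕ → ℕ → ℂ) (lam : ℕ) (b : ℕ → ℝ) (m n : ℕ) : ℝ≥0∞ :=
  (n : ℝ≥0∞)⁻¹ * ⨆ (N : ℕ) (_ : 1 ≤ N ∧ b n ≤ N ∧ (N : ℝ) ≤ lam * b n),
    ∑ k ∈ Finset.Icc N (2 * N), ‖c m k‖ₑ

/-- `₂γ_{mn} = (1/(mn)) sup_{M + N ≥ b(m+n)} ∑_{j=M}^{2M} ∑_{k=N}^{2N} |c_{jk}|`, with `M`, `N`
positive integers. -/
noncomputable def gammaTwo (c : ℕ → ℕ → ℂ) (b : ℕ → ℝ) (m n : ℕ) : ℝ≥0∞ :=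
  ((m : ℝ≥0∞) * (n : ℝ≥0∞))⁻¹ *
    ⨆ (M : ℕ) (N : ℕ) (_ : 1 ≤ M ∧ 1 ≤ N ∧ b (m + n) ≤ (M : ℝ) + N),
      ∑ j ∈ Finset.Icc M (2 * M), ∑ k ∈ Finset.Icc N (2 * N), ‖c j k‖ₑ

/-- The class `DGM(p, ₂α, ₂β, ₂γ, r)`: the parameters `λ ≥ 2` and `b₁, b₂, b₃` (positive sequences
tending to infinity, not necessarily monotonically) in the definition of `₂α, ₂β, ₂γ` may depend on
the sequence `c`. -/
def DGMTwo (p : ℝ) (r : ℕ) : Set (ℕ → ℕ → ℂ) :=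
  {c | ∃ lam : ℕ, 2 ≤ lam ∧ ∃ b₁ b₂ b₃ : ℕ → ℝ,
    (∀ l, 1 ≤ l → 0 < b₁ l ∧ 0 < b₂ l ∧ 0 < b₃ l) ∧
    Tendsto b₁ atTop atTop ∧ Tendsto b₂ atTop atTop ∧ Tendsto b₃ atTop atTop ∧
    c ∈ DGM p (alphaTwo c lam b₁) (betaTwo c lam b₂) (gammaTwo c b₃) r}

/-- The filter on pairs `(m, n)` of positive integers expressing `m + n → ∞`. -/
def sumAtTop : Filter (ℕ × ℕ) :=
  comap (fun q : ℕ × ℕ => q.1 + q.2) atTop ⊓ 𝓟 {q | 1 ≤ q.1 ∧ 1 ≤ q.2}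

/-- Regular convergence of the double series `∑_{j≥1} ∑_{k≥1} a_{jk}`: the rectangular partial sums
converge as `m, n → ∞` independently, and every column series and every row series converges. -/
def RegularlyConvergent (a : ℕ → ℕ → ℂ) : Prop :=
  (∃ s : ℂ, Tendsto
    (fun q : ℕ × ℕ => ∑ j ∈ Finset.Icc 1 q.1, ∑ k ∈ Finset.Icc 1 q.2, a j k) atTop (𝓝 s)) ∧
  (∀ n, 1 ≤ n → ∃ s : ℂ, Tendsto (fun M : ℕ => ∑ j ∈ Finset.Icc 1 M, a j n) atTop (𝓝 s)) ∧
  (∀ m, 1 ≤ m → ∃ s : ℂ, Tendsto (fun N : ℕ => ∑ k ∈ Finset.Icc 1 N, a m k) atTop (𝓝 s))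

/-- Uniform regular convergence of a double series of functions on `X`: the rectangular partial sums
and all the column and row series converge uniformly on `X`. -/
def UniformlyRegularlyConvergent {X : Type*} (f : ℕ → ℕ → X → ℂ) : Prop :=
  (∃ S : X → ℂ, TendstoUniformly
    (fun (q : ℕ × ℕ) (x : X) => ∑ j ∈ Finset.Icc 1 q.1, ∑ k ∈ Finset.Icc 1 q.2, f j k x)
      S atTop) ∧
  (∀ n, 1 ≤ n → ∃ S : X → ℂ,
    TendstoUniformly (fun (M : ℕ) (x : X) => ∑ j ∈ Finset.Icc 1 M, f j n x) S atTop) ∧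
  (∀ m, 1 ≤ m → ∃ S : X → ℂ,
    TendstoUniformly (fun (N : ℕ) (x : X) => ∑ k ∈ Finset.Icc 1 N, f m k x) S atTop)

/-- The term `c_{jk} sin(jx) sin(ky)` of the double sine series. -/
noncomputable def doubleSineTerm (c : ℕ → ℕ → ℂ) (j k : ℕ) (z : ℝ × ℝ) : ℂ :=
  c j k * (Real.sin (j * z.1) : ℂ) * (Real.sin (k * z.2) : ℂ)

/-!
Uniform regular convergence is a Cauchy property: the difference of two large rectangular sums is a
union of two strips `m < j ≤ M`, `k ≤ N` (or the same with `j` and `k` exchanged), so it is enough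
to make such strips small for large `m`, uniformly in `M`, `N`, `x`, `y`
(`eventually_norm_sum_strip_le`), and to do the same for single rows and columns.

Write `x = 2 π l / r + t` with the nearest such point, and let `a` be a cut of size about `1 / |t|`.
Summation by parts with step `r` has denominator `|e^{irx} - 1| ≥ |t| / 2`, so it costs a factor of
order `a`. For `p > 1`, Hölder's inequality on dyadic blocks bounds the variation beyond `n` only
by `n ^ (-1/p)`, which does not compensate this factor at `n = a`. It does at `n = a ^ q` with
`q ≥ p`, and the gap between `a` and `a ^ q` is where the logarithm in the hypotheses is used:
`∑ 1 / (k log k)` over `a < k ≤ a ^ q` is at most `q`. This is `sum_norm_sine_tail_le`. It is stated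
for a finite family of sequences `dᵢ` under a bound on `∑ᵢ |dᵢ k|`, because in a strip it is applied
both to the columns `j ↦ c j k` and to the rows `k ↦ c j k`, with the sum over the other index taken
outside. There the windows `[b, 2 λ b]` of the class matter: a sum over one window of the total
masses `∑ᵢ |dᵢ k|` bounds the sum over `i` of the maxima.

Below both cuts, `sin jx sin ky` differs from its value at the nearest points by at most
`j |t| + k |s|`; the tail conditions make the total of these errors small
(`norm_sum_below_cuts_le`), and the sum at the points is small by regular convergence there
(`RegularlyConvergent.eventually_strip`). The index `1` is special because `log 1 = 0`: the column
`k = 1` need not be absolutely summable, and is handled by the one-dimensional form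
`eventually_norm_sum_sin_le` of the same argument.
-/


/-! ### Elementary estimates -/

lemma half_le_log {k : ℕ} (hk : 2 ≤ k) : (1 / 2 : ℝ) ≤ Real.log k := by
  have h : Real.log 2 ≤ Real.log k := Real.log_le_log (by norm_num) (by exact_mod_cast hk)
  have := Real.log_two_gt_d9
  linarith

/-- The weight `k log k` dominates `k / 2` away from `k = 1`. -/
lemma mul_le_of_weight_le {k : ℕ} (hk : 2 ≤ k) {h ε : ℝ} (hh : 0 ≤ h)
    (H : k * Real.log k * h ≤ ε) : k * h ≤ 2 * ε := by
  have h1 := half_le_log hk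
  have h2 : 0 ≤ (k : ℝ) * h := by positivity
  nlinarith [mul_le_mul_of_nonneg_left h1 h2]

lemma sum_Ioc_inv_le_log {a b : ℕ} (ha : 1 ≤ a) (hab : a ≤ b) :
    ∑ k ∈ Finset.Ioc a b, (k : ℝ)⁻¹ ≤ Real.log b - Real.log a := by
  induction b, hab using Nat.le_induction with
  | base => simp
  | succ b hb ih =>
    rw [Finset.sum_Ioc_succ_top (by omega)]
    have hb0 : (0 : ℝ) < b := by exact_mod_cast (by omega : 0 < b)
    have h := Real.one_sub_inv_le_log_of_pos (x := ((b : ℝ) + 1) / b) (by positivity)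
    rw [Real.log_div (by positivity) hb0.ne', inv_div] at h
    have h3 : 1 - (b : ℝ) / (b + 1) = ((b : ℝ) + 1)⁻¹ := by field_simp; ring
    push_cast
    linarith

/-- Since `∑ 1 / (k log k)` over `n < k ≤ n ^ q` is bounded in terms of `q` alone, so is any sum
with terms dominated by it. -/
lemma sum_Ioc_pow_le {h : ℕ → ℝ} {ε : ℝ} {n q : ℕ} (hn : 2 ≤ n) (hq : 1 ≤ q) (hε : 0 ≤ ε)
    (H : ∀ k, n < k → k * Real.log k * h k ≤ ε) :
    ∑ k ∈ Finset.Ioc n (n ^ q), h k ≤ q * ε := by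
  have hln : 0 < Real.log n := by linarith [half_le_log hn]
  have h1 : ∀ k ∈ Finset.Ioc n (n ^ q), h k ≤ ε / Real.log n * (k : ℝ)⁻¹ := by
    intro k hk
    have hnk := (Finset.mem_Ioc.1 hk).1
    have hk0 : (0 : ℝ) < k := by exact_mod_cast (by omega : 0 < k)
    have hlk : Real.log n ≤ Real.log k :=
      Real.log_le_log (by exact_mod_cast (by omega : 0 < n)) (by exact_mod_cast hnk.le)
    have h2 : h k ≤ ε / (k * Real.log k) := by
      rw [le_div_iff₀ (mul_pos hk0 (by linarith))]
      linarith [H k hnk]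
    refine h2.trans ?_
    rw [div_mul_eq_mul_div, ← div_eq_mul_inv, div_div]
    exact div_le_div_of_nonneg_left hε (by positivity) (by gcongr)
  refine (Finset.sum_le_sum h1).trans ?_
  rw [← Finset.mul_sum]
  have h2 := sum_Ioc_inv_le_log (a := n) (b := n ^ q) (by omega) (Nat.le_self_pow (by omega) n)
  push_cast at h2
  rw [Real.log_pow] at h2
  calc ε / Real.log n * ∑ k ∈ Finset.Ioc n (n ^ q), (k : ℝ)⁻¹
      ≤ ε / Real.log n * (q * Real.log n) := by gcongr; linarith
    _ = q * ε := by field_simp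

lemma sum_Ioc_split {E : Type*} [AddCommMonoid E] (f : ℕ → E) {m n : ℕ} (h : m ≤ n) (M : ℕ) :
    ∑ j ∈ Finset.Ioc m M, f j
      = ∑ j ∈ Finset.Ioc m (min M n), f j + ∑ j ∈ Finset.Ioc n M, f j := by
  rcases le_total M n with hM | hM
  · rw [min_eq_left hM, Finset.Ioc_eq_empty_of_le hM]; simp
  · rw [min_eq_right hM, Finset.sum_Ioc_consecutive f h hM]

lemma sum_Icc_eq_add_Ioc {E : Type*} [AddCommMonoid E] (f : ℕ → E) {m M : ℕ} (h : m ≤ M) :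
    ∑ j ∈ Finset.Icc 1 M, f j = ∑ j ∈ Finset.Icc 1 m, f j + ∑ j ∈ Finset.Ioc m M, f j := by
  have h0 : ∀ n, Finset.Icc 1 n = Finset.Ioc 0 n := fun n => by ext; simp; omega
  rw [h0, h0, Finset.sum_Ioc_consecutive f (Nat.zero_le _) h]

/-! ### Summation by parts with step `r` -/

lemma norm_sum_mul_pow_le (r : ℕ) (d : ℕ → ℂ) {n N : ℕ} (hnN : n ≤ N) {z : ℂ} (hz : ‖z‖ = 1) :
    ‖z ^ r - 1‖ * ‖∑ k ∈ Finset.Ioc n N, d k * z ^ k‖ ≤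
      ∑ k ∈ Finset.Ioc n N, ‖d k - d (k + r)‖ + ∑ k ∈ Finset.Ioc n (n + r), ‖d k‖
        + ∑ k ∈ Finset.Ioc N (N + r), ‖d k‖ := by
  have hshift : ∑ k ∈ Finset.Ioc n N, d (k + r) * z ^ (k + r)
      = ∑ k ∈ Finset.Ioc (n + r) (N + r), d k * z ^ k := by
    rw [← Finset.map_add_right_Ioc, Finset.sum_map]
    rfl
  have hsplit : ∑ k ∈ Finset.Ioc n (n + r), d k * z ^ k
        + ∑ k ∈ Finset.Ioc (n + r) (N + r), d k * z ^ k
      = ∑ k ∈ Finset.Ioc n N, d k * z ^ k + ∑ k ∈ Finset.Ioc N (N + r), d k * z ^ k := by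
    rw [Finset.sum_Ioc_consecutive _ (by omega) (by omega),
      Finset.sum_Ioc_consecutive _ (by omega) (by omega)]
  have hdiff : ∑ k ∈ Finset.Ioc n N, (d k - d (k + r)) * z ^ (k + r)
      = z ^ r * ∑ k ∈ Finset.Ioc n N, d k * z ^ k
        - ∑ k ∈ Finset.Ioc (n + r) (N + r), d k * z ^ k := by
    rw [← hshift, Finset.mul_sum, ← Finset.sum_sub_distrib]
    exact Finset.sum_congr rfl fun k _ => by ring
  have key : (z ^ r - 1) * ∑ k ∈ Finset.Ioc n N, d k * z ^ k
      = ∑ k ∈ Finset.Ioc n N, (d k - d (k + r)) * z ^ (k + r)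
        - ∑ k ∈ Finset.Ioc n (n + r), d k * z ^ k
        + ∑ k ∈ Finset.Ioc N (N + r), d k * z ^ k := by
    rw [hdiff]
    linear_combination hsplit
  have hb : ∀ (s : Finset ℕ) (u : ℕ → ℂ) (e : ℕ → ℕ),
      ‖∑ k ∈ s, u k * z ^ e k‖ ≤ ∑ k ∈ s, ‖u k‖ := fun s u e =>
    (norm_sum_le _ _).trans_eq (Finset.sum_congr rfl fun k _ => by simp [hz])
  rw [← norm_mul, key]
  refine (norm_add_le _ _).trans (add_le_add ((norm_sub_le _ _).trans (add_le_add ?_ ?_)) ?_)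
  · exact hb _ _ (fun k => k + r)
  · exact hb _ _ (fun k => k)
  · exact hb _ _ (fun k => k)

lemma norm_sum_mul_sin_le (r : ℕ) (d : ℕ → ℂ) {n N : ℕ} (hnN : n ≤ N) (y : ℝ) :
    ‖Complex.exp (y * Complex.I) ^ r - 1‖
        * ‖∑ k ∈ Finset.Ioc n N, d k * (Real.sin (k * y) : ℂ)‖ ≤
      ∑ k ∈ Finset.Ioc n N, ‖d k - d (k + r)‖ + ∑ k ∈ Finset.Ioc n (n + r), ‖d k‖
        + ∑ k ∈ Finset.Ioc N (N + r), ‖d k‖ := by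
  set z : ℂ := Complex.exp (y * Complex.I) with hzdef
  set w : ℂ := (starRingEnd ℂ) z with hwdef
  have hz : ‖z‖ = 1 := Complex.norm_exp_ofReal_mul_I y
  have hw : ‖w‖ = 1 := by rw [hwdef, RCLike.norm_conj, hz]
  have hwexp : w = Complex.exp (-(y * Complex.I)) := by
    rw [hwdef, hzdef, ← Complex.exp_conj]
    simp
  have hwr : ‖w ^ r - 1‖ = ‖z ^ r - 1‖ := by
    have h : w ^ r - 1 = (starRingEnd ℂ) (z ^ r - 1) := by simp [hwdef]
    rw [h, RCLike.norm_conj]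
  have h1 := norm_sum_mul_pow_le r d hnN hz
  have h2 := norm_sum_mul_pow_le r d hnN hw
  rw [hwr] at h2
  have hs : ∑ k ∈ Finset.Ioc n N, d k * (Real.sin (k * y) : ℂ)
      = (∑ k ∈ Finset.Ioc n N, d k * w ^ k - ∑ k ∈ Finset.Ioc n N, d k * z ^ k)
        * (Complex.I / 2) := by
    rw [← Finset.sum_sub_distrib, Finset.sum_mul]
    refine Finset.sum_congr rfl fun k _ => ?_
    rw [hwexp, hzdef, ← Complex.exp_nat_mul, ← Complex.exp_nat_mul, Complex.ofReal_sin,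
      Complex.sin]
    push_cast
    rw [show -((k : ℂ) * y) * Complex.I = k * -(y * Complex.I) by ring,
      show (k : ℂ) * y * Complex.I = k * (y * Complex.I) by ring]
    ring
  have h3 : ‖∑ k ∈ Finset.Ioc n N, d k * (Real.sin (k * y) : ℂ)‖
      ≤ (‖∑ k ∈ Finset.Ioc n N, d k * w ^ k‖ + ‖∑ k ∈ Finset.Ioc n N, d k * z ^ k‖) / 2 := by
    rw [hs, norm_mul]
    have : ‖Complex.I / 2‖ = 1 / 2 := by simp
    rw [this]
    linarith [norm_sub_le (∑ k ∈ Finset.Ioc n N, d k * w ^ k) (∑ k ∈ Finset.Ioc n N, d k * z ^ k)]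
  have h4 := mul_le_mul_of_nonneg_left h3 (norm_nonneg (z ^ r - 1))
  linarith

/-! ### Tails of sine sums away from the points `2 π l / r` -/

/-- The `ℓ¹` form of a `p`-bounded variation condition: on `[n, 2n)` the `r`-step variation of `d`
is at most `C n ^ (-1/p)` times the mass of `d` on the window `[L n, Λ L n]`. -/
def BlockVariation (p : ℝ) (r : ℕ) (C : ℝ) (Λ n₀ : ℕ) (L : ℕ → ℕ) (d : ℕ → ℂ) : Prop :=
  ∀ n, n₀ ≤ n → ∑ k ∈ Finset.Ico n (2 * n), ‖d k - d (k + r)‖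
    ≤ C * (n : ℝ) ^ (-(1 / p)) * ∑ k ∈ Finset.Icc (L n) (Λ * L n), ‖d k‖

/-- The constant of `sum_norm_sine_tail_le`. -/
noncomputable def tailConst (p : ℝ) (r q : ℕ) (C : ℝ) (Λ : ℕ) : ℝ :=
  q + 2 * C * Λ / (1 - (2 : ℝ) ^ (-(1 / p))) + 4 * r

lemma two_rpow_neg_lt_one {p : ℝ} (hp : 0 < p) : (2 : ℝ) ^ (-(1 / p)) < 1 :=
  Real.rpow_lt_one_of_one_lt_of_neg (by norm_num) (by simpa using hp)

lemma tailConst_nonneg {p : ℝ} (hp : 0 < p) (r q : ℕ) {C : ℝ} (hC : 0 ≤ C) (Λ : ℕ) :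
    0 ≤ tailConst p r q C Λ := by
  have := sub_pos.2 (two_rpow_neg_lt_one hp)
  unfold tailConst
  positivity

/-- The dyadic blocks `[2 ^ u n, 2 ^ (u + 1) n)` contribute a geometric series. -/
lemma sum_variation_dyadic_le {p A : ℝ} (hp : 0 < p) (hA : 0 ≤ A) {v : ℕ → ℝ} {n₀ : ℕ}
    (hv : ∀ n, n₀ ≤ n → ∑ k ∈ Finset.Ico n (2 * n), v k ≤ A * (n : ℝ) ^ (-(1 / p))) (u : ℕ) :
    ∀ n, n₀ ≤ n → ∑ k ∈ Finset.Ico n (2 ^ u * n), v k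
      ≤ A / (1 - (2 : ℝ) ^ (-(1 / p))) * (n : ℝ) ^ (-(1 / p)) := by
  have h1 := sub_pos.2 (two_rpow_neg_lt_one hp)
  induction u with
  | zero =>
    intro n _
    simp only [pow_zero, one_mul, Finset.Ico_self, Finset.sum_empty]
    positivity
  | succ u ih =>
    intro n hn
    have hle : 2 * n ≤ 2 ^ u * (2 * n) := Nat.le_mul_of_pos_left _ (by positivity)
    rw [show 2 ^ (u + 1) * n = 2 ^ u * (2 * n) by ring,
      ← Finset.sum_Ico_consecutive v (by omega : n ≤ 2 * n) hle]
    have h2 := ih (2 * n) (by omega)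
    have h3 : ((2 * n : ℕ) : ℝ) ^ (-(1 / p)) = (2 : ℝ) ^ (-(1 / p)) * (n : ℝ) ^ (-(1 / p)) := by
      push_cast
      exact Real.mul_rpow (by norm_num) (by positivity)
    rw [h3] at h2
    refine (add_le_add (hv n hn) h2).trans_eq ?_
    field_simp
    ring

/-- If `k log k ∑ᵢ |dᵢ k| ≤ ε`, then away from the points `2 π l / r`, on the scale `n` given by
`1 ≤ n |e^{iry} - 1|`, the sine sums beyond `n` are `O(ε)`. Up to `n ^ q` the terms are summed in
absolute value; beyond `n ^ q`, summation by parts costs a factor `1 / |e^{iry} - 1| ≤ n`, which the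
factor `(n ^ q) ^ (-1/p) ≤ 1 / n` of the variation absorbs. -/
theorem sum_norm_sine_tail_le {ι : Type*} (I : Finset ι) (d : ι → ℕ → ℂ) {p C ε : ℝ}
    {r q K Λ n₀ : ℕ} {L : ℕ → ℕ} (hp : 1 < p) (hq : p ≤ q) (hε : 0 ≤ ε) (hC : 0 ≤ C)
    (hH : ∀ k, K < k → k * Real.log k * ∑ i ∈ I, ‖d i k‖ ≤ ε)
    (hvar : ∀ i ∈ I, BlockVariation p r C Λ n₀ L (d i))
    {n : ℕ} (hK : 1 ≤ K) (hKn : K ≤ n) (hn : 2 ≤ n) (hn₀ : n₀ ≤ n)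
    (hL : ∀ n', n ≤ n' → K < L n') (N : ℕ) (y : ℝ)
    (hy : 1 ≤ n * ‖Complex.exp (y * Complex.I) ^ r - 1‖ ∨ N ≤ n) :
    ∑ i ∈ I, ‖∑ k ∈ Finset.Ioc n N, d i k * (Real.sin (k * y) : ℂ)‖
      ≤ tailConst p r q C Λ * ε := by
  have hp0 : 0 < p := by linarith
  have hgeo := sub_pos.2 (two_rpow_neg_lt_one hp0)
  rcases le_or_gt N n with hNn | hNn
  · rw [Finset.Ioc_eq_empty_of_le hNn]
    simpa using mul_nonneg (tailConst_nonneg hp0 r q hC Λ) hε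
  have hy : 1 ≤ n * ‖Complex.exp (y * Complex.I) ^ r - 1‖ := hy.resolve_right (by omega)
  set δ := ‖Complex.exp (y * Complex.I) ^ r - 1‖ with hδ
  have hq1 : 1 ≤ q := by
    have : (1 : ℝ) < q := lt_of_lt_of_le hp hq
    exact_mod_cast this.le
  set B := n ^ q with hB
  have hnB : n ≤ B := Nat.le_self_pow (by omega) n
  have hH0 : ∀ k, 0 ≤ ∑ i ∈ I, ‖d i k‖ := fun k => Finset.sum_nonneg fun _ _ => norm_nonneg _
  have hH2 : ∀ k, K < k → k * ∑ i ∈ I, ‖d i k‖ ≤ 2 * ε := fun k hk =>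
    mul_le_of_weight_le (by omega) (hH0 k) (hH k hk)
  have hnorm : ∀ (i : ι) (s : Finset ℕ),
      ‖∑ k ∈ s, d i k * (Real.sin (k * y) : ℂ)‖ ≤ ∑ k ∈ s, ‖d i k‖ := by
    intro i s
    refine (norm_sum_le _ _).trans (Finset.sum_le_sum fun k _ => ?_)
    rw [norm_mul, Complex.norm_real]
    exact mul_le_of_le_one_right (norm_nonneg _) (Real.abs_sin_le_one _)
  -- the middle range `(n, n ^ q]`, in absolute value
  have hmid : ∑ i ∈ I, ‖∑ k ∈ Finset.Ioc n (min N B), d i k * (Real.sin (k * y) : ℂ)‖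
      ≤ q * ε := by
    calc _ ≤ ∑ i ∈ I, ∑ k ∈ Finset.Ioc n B, ‖d i k‖ := by
          refine Finset.sum_le_sum fun i _ => (hnorm i _).trans ?_
          exact Finset.sum_le_sum_of_subset_of_nonneg
            (Finset.Ioc_subset_Ioc_right (min_le_right _ _)) fun _ _ _ => norm_nonneg _
      _ = ∑ k ∈ Finset.Ioc n B, ∑ i ∈ I, ‖d i k‖ := Finset.sum_comm
      _ ≤ q * ε := sum_Ioc_pow_le hn hq1 hε fun k hk => hH k (by omega)
  -- the variation of the whole family
  have hvarI : ∀ n', n ≤ n' → ∑ k ∈ Finset.Ico n' (2 * n'), ∑ i ∈ I, ‖d i k - d i (k + r)‖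
      ≤ 2 * C * Λ * ε * (n' : ℝ) ^ (-(1 / p)) := by
    intro n' hn'
    have hwin : ∑ k ∈ Finset.Icc (L n') (Λ * L n'), ∑ i ∈ I, ‖d i k‖ ≤ 2 * Λ * ε := by
      have hLK := hL n' hn'
      have hL0 : (0 : ℝ) < L n' := by exact_mod_cast (by omega : 0 < L n')
      have hterm : ∀ k ∈ Finset.Icc (L n') (Λ * L n'), ∑ i ∈ I, ‖d i k‖ ≤ 2 * ε / L n' := by
        intro k hk
        have hk' := (Finset.mem_Icc.1 hk).1
        rw [le_div_iff₀ hL0, mul_comm]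
        refine le_trans ?_ (hH2 k (by omega))
        exact mul_le_mul_of_nonneg_right (by exact_mod_cast hk') (hH0 k)
      refine (Finset.sum_le_card_nsmul _ _ _ hterm).trans ?_
      rw [nsmul_eq_mul, Nat.card_Icc]
      have hcard : ((Λ * L n' + 1 - L n' : ℕ) : ℝ) ≤ Λ * L n' := by
        exact_mod_cast (by omega : Λ * L n' + 1 - L n' ≤ Λ * L n')
      calc _ ≤ (Λ * L n' : ℝ) * (2 * ε / L n') := by gcongr
        _ = 2 * Λ * ε := by field_simp
    rw [Finset.sum_comm]
    calc _ ≤ ∑ i ∈ I, C * (n' : ℝ) ^ (-(1 / p)) * ∑ k ∈ Finset.Icc (L n') (Λ * L n'), ‖d i k‖ :=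
          Finset.sum_le_sum fun i hi => hvar i hi n' (by omega)
      _ = C * (n' : ℝ) ^ (-(1 / p)) * ∑ k ∈ Finset.Icc (L n') (Λ * L n'), ∑ i ∈ I, ‖d i k‖ := by
          rw [← Finset.mul_sum, Finset.sum_comm]
      _ ≤ C * (n' : ℝ) ^ (-(1 / p)) * (2 * Λ * ε) := by gcongr
      _ = _ := by ring
  set D := 2 * C * Λ / (1 - (2 : ℝ) ^ (-(1 / p))) with hD
  -- the far range `(n ^ q, N]`, by summation by parts
  have hfar : ∑ i ∈ I, ‖∑ k ∈ Finset.Ioc B N, d i k * (Real.sin (k * y) : ℂ)‖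
      ≤ (D + 4 * r) * ε := by
    have hD0 : 0 ≤ D := by positivity
    rcases le_or_gt N B with hNB | hNB
    · rw [Finset.Ioc_eq_empty_of_le hNB]
      simp only [Finset.sum_empty, norm_zero, Finset.sum_const_zero]
      positivity
    have hn0 : (0 : ℝ) < n := by exact_mod_cast (by omega : 0 < n)
    have hV : ∑ k ∈ Finset.Ioc B N, ∑ i ∈ I, ‖d i k - d i (k + r)‖ ≤ D * ε / n := by
      have hsub : Finset.Ioc B N ⊆ Finset.Ico B (2 ^ (N + 1) * B) := by
        intro k hk
        rw [Finset.mem_Ioc] at hk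
        rw [Finset.mem_Ico]
        refine ⟨by omega, ?_⟩
        have h1 : N + 1 < 2 ^ (N + 1) := Nat.lt_two_pow_self
        have h2 : 2 ^ (N + 1) ≤ 2 ^ (N + 1) * B := Nat.le_mul_of_pos_right _ (by omega)
        omega
      refine (Finset.sum_le_sum_of_subset_of_nonneg hsub fun _ _ _ =>
        Finset.sum_nonneg fun _ _ => norm_nonneg _).trans ?_
      refine (sum_variation_dyadic_le hp0 (by positivity) hvarI (N + 1) B hnB).trans ?_
      have hpow : (B : ℝ) ^ (-(1 / p)) ≤ 1 / n := by
        rw [hB, Nat.cast_pow, ← Real.rpow_natCast, ← Real.rpow_mul hn0.le,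
          one_div (n : ℝ), ← Real.rpow_neg_one]
        refine Real.rpow_le_rpow_of_exponent_le
          (by exact_mod_cast (by omega : 1 ≤ n) : (1 : ℝ) ≤ n) ?_
        have : 1 ≤ (q : ℝ) * (1 / p) := by
          rw [mul_one_div, le_div_iff₀ hp0]; linarith
        linarith
      calc _ = D * ε * (B : ℝ) ^ (-(1 / p)) := by rw [hD]; ring
        _ ≤ D * ε * (1 / n) := by gcongr
        _ = _ := by ring
    have hbd : ∀ n', n ≤ n' → ∑ k ∈ Finset.Ioc n' (n' + r), ∑ i ∈ I, ‖d i k‖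
        ≤ 2 * r * ε / n := by
      intro n' hn'
      have hterm : ∀ k ∈ Finset.Ioc n' (n' + r), ∑ i ∈ I, ‖d i k‖ ≤ 2 * ε / n := by
        intro k hk
        have hk' := (Finset.mem_Ioc.1 hk).1
        rw [le_div_iff₀ hn0, mul_comm]
        refine le_trans ?_ (hH2 k (by omega))
        exact mul_le_mul_of_nonneg_right (by exact_mod_cast (by omega : n ≤ k)) (hH0 k)
      refine (Finset.sum_le_card_nsmul _ _ _ hterm).trans_eq ?_
      rw [nsmul_eq_mul, Nat.card_Ioc, Nat.add_sub_cancel_left]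
      ring
    have hAbel : δ * ∑ i ∈ I, ‖∑ k ∈ Finset.Ioc B N, d i k * (Real.sin (k * y) : ℂ)‖
        ≤ (D + 4 * r) * ε / n := by
      rw [Finset.mul_sum]
      refine (Finset.sum_le_sum fun i _ => norm_sum_mul_sin_le r (d i) hNB.le y).trans ?_
      rw [Finset.sum_add_distrib, Finset.sum_add_distrib, Finset.sum_comm,
        Finset.sum_comm (s := I) (t := Finset.Ioc B (B + r)),
        Finset.sum_comm (s := I) (t := Finset.Ioc N (N + r))]
      refine (add_le_add (add_le_add hV (hbd B hnB)) (hbd N (by omega))).trans_eq ?_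
      ring
    rw [le_div_iff₀ hn0] at hAbel
    set S := ∑ i ∈ I, ‖∑ k ∈ Finset.Ioc B N, d i k * (Real.sin (k * y) : ℂ)‖ with hS
    have hS0 : 0 ≤ S := Finset.sum_nonneg fun _ _ => norm_nonneg _
    nlinarith [mul_le_mul_of_nonneg_right hy hS0]
  calc _ ≤ ∑ i ∈ I, (‖∑ k ∈ Finset.Ioc n (min N B), d i k * (Real.sin (k * y) : ℂ)‖
        + ‖∑ k ∈ Finset.Ioc B N, d i k * (Real.sin (k * y) : ℂ)‖) := by
        refine Finset.sum_le_sum fun i _ => ?_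
        rw [sum_Ioc_split _ hnB N]
        exact norm_add_le _ _
    _ ≤ q * ε + (D + 4 * r) * ε := by
        rw [Finset.sum_add_distrib]; exact add_le_add hmid hfar
    _ = tailConst p r q C Λ * ε := by unfold tailConst; ring

/-! ### The nearest point `2 π l / r` -/

lemma exists_nearest_point {r : ℕ} (hr : 1 ≤ r) (x : ℝ) :
    ∃ l < r, ∃ t : ℝ, 0 ≤ t ∧ t ≤ 4 ∧
      (∀ j : ℕ, |Real.sin (j * x) - Real.sin (j * (2 * (l : ℝ) * Real.pi / r))| ≤ j * t) ∧
      t / 2 ≤ ‖Complex.exp (x * Complex.I) ^ r - 1‖ := by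
  have hr0 : (0 : ℝ) < r := by exact_mod_cast hr
  have hr1 : (1 : ℝ) ≤ r := by exact_mod_cast hr
  have hpi := Real.pi_pos
  have hpi4 := Real.pi_le_four
  set z : ℤ := round (r * x / (2 * Real.pi)) with hz
  set u : ℝ := x - 2 * z * Real.pi / r with hu
  have hround := abs_sub_round (r * x / (2 * Real.pi))
  rw [← hz] at hround
  have hru : r * u = 2 * Real.pi * (r * x / (2 * Real.pi) - z) := by
    rw [hu]; field_simp
  have hru' : |r * u| ≤ Real.pi := by
    rw [hru, abs_mul, abs_of_pos (by positivity)]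
    nlinarith
  have hur : |u| ≤ |r * u| := by
    rw [abs_mul, abs_of_pos hr0]
    exact le_mul_of_one_le_left (abs_nonneg _) hr1
  have hrz : (0 : ℤ) < r := by exact_mod_cast hr
  have hmod0 := Int.emod_nonneg z hrz.ne'
  have hmodlt := Int.emod_lt_of_pos z hrz
  refine ⟨(z % r).toNat, by omega, |u|, abs_nonneg _, by linarith, ?_, ?_⟩
  · intro j
    have hl : (((z % r).toNat : ℕ) : ℝ) = z - r * ((z / r : ℤ) : ℝ) := by
      have h1 : (((z % r).toNat : ℕ) : ℤ) = z - r * (z / r) := by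
        rw [Int.toNat_of_nonneg hmod0, Int.emod_def]
      exact_mod_cast h1
    have harg : (j : ℝ) * (2 * (((z % r).toNat : ℕ) : ℝ) * Real.pi / r)
        = j * (x - u) - ((j * (z / r) : ℤ) : ℝ) * (2 * Real.pi) := by
      rw [hl, hu]; push_cast; field_simp; ring
    rw [harg, Real.sin_sub_int_mul_two_pi]
    refine (Real.abs_sin_sub_sin_le _ _).trans_eq ?_
    rw [show (j : ℝ) * x - j * (x - u) = j * u by ring, abs_mul, Nat.abs_cast]
  · have hexp : Complex.exp (x * Complex.I) ^ r
        = Complex.exp (Complex.I * ((r * u : ℝ) : ℂ)) := by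
      rw [← Complex.exp_nat_mul]
      have : (r : ℂ) * (x * Complex.I)
          = Complex.I * ((r * u : ℝ) : ℂ) + z * (2 * Real.pi * Complex.I) := by
        rw [hu]; push_cast
        have : (r : ℂ) ≠ 0 := by exact_mod_cast hr0.ne'
        field_simp; ring
      rw [this, Complex.exp_add, Complex.exp_int_mul_two_pi_mul_I, mul_one]
    rw [hexp, Complex.norm_exp_I_mul_ofReal_sub_one, Real.norm_eq_abs, abs_mul,
      abs_of_pos (by norm_num : (0 : ℝ) < 2)]
    have hhalf : |r * u / 2| = |r * u| / 2 := by rw [abs_div]; norm_num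
    have h := Real.mul_abs_le_abs_sin (x := r * u / 2) (by rw [hhalf]; linarith)
    rw [hhalf] at h
    have h2 : 1 / 4 ≤ 1 / Real.pi := by gcongr
    have h3 : 2 / Real.pi * (|r * u| / 2) = 1 / Real.pi * |r * u| := by ring
    have h4 := mul_le_mul_of_nonneg_right h2 (abs_nonneg (r * u))
    linarith

/-- A cut `a` of size about `1 / t`; when `t` vanishes, every index up to `N` is below the cut. -/
lemma exists_cut {t δ : ℝ} (ht0 : 0 ≤ t) (ht : t ≤ 4) (hδ : t / 2 ≤ δ) (K N : ℕ) :
    ∃ a : ℕ, K ≤ a ∧ a * t ≤ 4 * K + 6 ∧ (1 ≤ a * δ ∨ N ≤ a) := by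
  rcases ht0.eq_or_lt with rfl | ht1
  · refine ⟨max K N, le_max_left _ _, ?_, Or.inr (le_max_right _ _)⟩
    rw [mul_zero]; positivity
  · refine ⟨max K ⌈2 / t⌉₊, le_max_left _ _, ?_, Or.inl ?_⟩
    · have h1 : (⌈2 / t⌉₊ : ℝ) * t ≤ 6 := by
        have := (Nat.ceil_lt_add_one (by positivity : 0 ≤ 2 / t)).le
        calc (⌈2 / t⌉₊ : ℝ) * t ≤ (2 / t + 1) * t := by gcongr
          _ = 2 + t := by field_simp
          _ ≤ 6 := by linarith
      have h2 : (K : ℝ) * t ≤ 4 * K := by nlinarith [Nat.cast_nonneg (α := ℝ) K]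
      rcases max_cases K ⌈2 / t⌉₊ with ⟨h, _⟩ | ⟨h, _⟩ <;> rw [h]
      · linarith
      · have : (0 : ℝ) ≤ K := Nat.cast_nonneg K
        linarith
    · have h1 : 2 / t ≤ ((max K ⌈2 / t⌉₊ : ℕ) : ℝ) :=
        (Nat.le_ceil _).trans (by exact_mod_cast le_max_right _ _)
      calc (1 : ℝ) = 2 / t * (t / 2) := by field_simp
        _ ≤ _ := by gcongr

/-! ### Strips of rectangular sums -/

/-- Every column `j ↦ c j k`, `k ≥ 1`, satisfies `BlockVariation` with the same parameters, and the
windows move to infinity. -/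
def HasColumnVariation (p : ℝ) (r : ℕ) (c : ℕ → ℕ → ℂ) : Prop :=
  ∃ (C : ℝ) (Λ n₀ : ℕ) (L : ℕ → ℕ), 0 ≤ C ∧ Tendsto L atTop atTop ∧
    ∀ k, 1 ≤ k → BlockVariation p r C Λ n₀ L (fun j => c j k)

/-- `sup_{j ≥ m} j log j ∑_{k ≥ n} |c j k| → 0` as `m + n → ∞`, in terms of finite sums. -/
def HasLogTails (c : ℕ → ℕ → ℂ) : Prop :=
  ∀ ε > 0, ∃ K : ℕ, ∀ m n, 1 ≤ m → 1 ≤ n → K ≤ m + n → ∀ j, m ≤ j → ∀ N,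
    j * Real.log j * ∑ k ∈ Finset.Ico n N, ‖c j k‖ ≤ ε

/-- The value of `sin (j x)` at the point `x = 2 π l / r`. -/
noncomputable def pointSin (r l j : ℕ) : ℝ := Real.sin (j * (2 * (l : ℝ) * Real.pi / r))

lemma abs_pointSin_le_one (r l j : ℕ) : |pointSin r l j| ≤ 1 := Real.abs_sin_le_one _

lemma norm_mul_ofReal_le (w : ℂ) {s : ℝ} (hs : |s| ≤ 1) : ‖w * (s : ℂ)‖ ≤ ‖w‖ := by
  rw [norm_mul, Complex.norm_real]
  exact mul_le_of_le_one_right (norm_nonneg _) hs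

/-- A convergent series has small blocks far out. -/
lemma eventually_norm_sum_Ioc_le {a : ℕ → ℂ}
    (h : ∃ s, Tendsto (fun M : ℕ => ∑ j ∈ Finset.Icc 1 M, a j) atTop (𝓝 s)) {ε : ℝ} (hε : 0 < ε) :
    ∀ᶠ m in atTop, ∀ M, ‖∑ j ∈ Finset.Ioc m M, a j‖ ≤ ε := by
  obtain ⟨s, hs⟩ := h
  obtain ⟨K, hK⟩ := Metric.cauchySeq_iff.1 hs.cauchySeq ε hε
  filter_upwards [eventually_ge_atTop K] with m hm M
  rcases le_total M m with hM | hM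
  · rw [Finset.Ioc_eq_empty_of_le hM]; simpa using hε.le
  · have := hK M (le_trans hm hM) m hm
    rw [dist_eq_norm, sum_Icc_eq_add_Ioc _ hM, add_sub_cancel_left] at this
    exact this.le

/-- A regularly convergent double series has small sums over strips `m < j ≤ M`, `k ≤ N`, uniformly
in `M` and `N`: for large `N` by convergence of the rectangular sums, for the finitely many
remaining `N` by convergence of the columns. -/
lemma RegularlyConvergent.eventually_strip {a : ℕ → ℕ → ℂ} (h : RegularlyConvergent a) {ε : ℝ}
    (hε : 0 < ε) :
    ∀ᶠ m in atTop, ∀ M N, ‖∑ j ∈ Finset.Ioc m M, ∑ k ∈ Finset.Icc 1 N, a j k‖ ≤ ε := by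
  obtain ⟨⟨s, hs⟩, hcol, -⟩ := h
  obtain ⟨⟨K₁, K₂⟩, hK⟩ := Metric.cauchySeq_iff.1 hs.cauchySeq ε hε
  have hcols : ∀ᶠ m in atTop, ∀ n ∈ Finset.Icc 1 K₂, ∀ M,
      ‖∑ j ∈ Finset.Ioc m M, a j n‖ ≤ ε / (K₂ + 1) := by
    rw [Filter.eventually_all_finset]
    exact fun n hn => eventually_norm_sum_Ioc_le (hcol n (Finset.mem_Icc.1 hn).1) (by positivity)
  filter_upwards [eventually_ge_atTop K₁, hcols] with m hm hcm M N
  rcases le_total M m with hM | hM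
  · rw [Finset.Ioc_eq_empty_of_le hM]; simpa using hε.le
  rcases le_total K₂ N with hN | hN
  · have := hK (M, N) ⟨le_trans hm hM, hN⟩ (m, N) ⟨hm, hN⟩
    rw [dist_eq_norm, sum_Icc_eq_add_Ioc _ hM, add_sub_cancel_left] at this
    exact this.le
  · rw [Finset.sum_comm]
    refine (norm_sum_le _ _).trans ?_
    have hterm : ∀ k ∈ Finset.Icc 1 N, ‖∑ j ∈ Finset.Ioc m M, a j k‖ ≤ ε / (K₂ + 1) := by
      intro k hk
      rw [Finset.mem_Icc] at hk
      exact hcm k (Finset.mem_Icc.2 ⟨hk.1, hk.2.trans hN⟩) M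
    refine (Finset.sum_le_card_nsmul _ _ _ hterm).trans ?_
    rw [nsmul_eq_mul, Nat.card_Icc, Nat.add_sub_cancel]
    have hNK : (N : ℝ) ≤ K₂ + 1 := by exact_mod_cast (by omega : N ≤ K₂ + 1)
    calc (N : ℝ) * (ε / (K₂ + 1)) ≤ (K₂ + 1) * (ε / (K₂ + 1)) := by gcongr
      _ = ε := by field_simp

lemma RegularlyConvergent.swap {a : ℕ → ℕ → ℂ} (h : RegularlyConvergent a) :
    RegularlyConvergent (fun j k => a k j) := by
  obtain ⟨⟨s, hs⟩, h1, h2⟩ := h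
  refine ⟨⟨s, ?_⟩, h2, h1⟩
  have hsw : Tendsto (Prod.swap : ℕ × ℕ → ℕ × ℕ) atTop atTop := by
    rw [← Filter.prod_atTop_atTop_eq]
    exact tendsto_prod_swap
  refine (hs.comp hsw).congr fun q => ?_
  exact Finset.sum_comm

/-- One-dimensional case: a sequence with `j log j |d j| → 0` and `p`-bounded variation, whose sine
series converges at the points `2 π l / r`, has small sine sums far out, uniformly in `x`. -/
lemma eventually_norm_sum_sin_le {p : ℝ} {r : ℕ} (hp : 1 < p) (hr : 1 ≤ r) {d : ℕ → ℂ}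
    {C : ℝ} {Λ n₀ : ℕ} {L : ℕ → ℕ} (hC : 0 ≤ C) (hL : Tendsto L atTop atTop)
    (hd : BlockVariation p r C Λ n₀ L d)
    (hlog : ∀ ε > 0, ∃ K, ∀ j : ℕ, K < j → j * Real.log j * ‖d j‖ ≤ ε)
    (hpt : ∀ l < r, ∃ s, Tendsto
      (fun M : ℕ => ∑ j ∈ Finset.Icc 1 M, d j * (pointSin r l j : ℂ)) atTop (𝓝 s))
    {ε' : ℝ} (hε' : 0 < ε') :
    ∀ᶠ m in atTop, ∀ (M : ℕ) (x : ℝ),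
      ‖∑ j ∈ Finset.Ioc m M, d j * (Real.sin (j * x) : ℂ)‖ ≤ ε' := by
  obtain ⟨q, hq⟩ := exists_nat_ge p
  set G := tailConst p r q C Λ with hG
  have hG0 : 0 ≤ G := tailConst_nonneg (by linarith) r q hC Λ
  set ε := ε' / (G + 21) with hεdef
  have hε : 0 < ε := by positivity
  obtain ⟨K₀, hK₀⟩ := hlog ε hε
  set K := max K₀ 1 with hKdef
  have hpts : ∀ᶠ m in atTop, ∀ l ∈ Finset.range r, ∀ M,
      ‖∑ j ∈ Finset.Ioc m M, d j * (pointSin r l j : ℂ)‖ ≤ ε := by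
    rw [Filter.eventually_all_finset]
    exact fun l hl => eventually_norm_sum_Ioc_le (hpt l (Finset.mem_range.1 hl)) hε
  have hLev : ∀ᶠ m in atTop, ∀ n', m ≤ n' → K < L n' :=
    eventually_forall_ge_atTop.2 (hL.eventually_gt_atTop K)
  filter_upwards [hpts, hLev, eventually_ge_atTop (max K (max 2 n₀))] with m hpm hLm hm M x
  simp only [max_le_iff] at hm
  obtain ⟨l, hl, t, ht0, ht4, htx, htδ⟩ := exists_nearest_point hr x
  obtain ⟨a, -, hat, ha⟩ := exists_cut ht0 ht4 htδ 1 M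
  have htail := sum_norm_sine_tail_le (Finset.univ : Finset Unit) (fun _ => d) (K := K)
    (n := max m a) hp hq hε.le hC
    (by intro k hk; simpa using hK₀ k (by omega)) (fun _ _ => hd) (by omega) (by omega) (by omega)
    (by omega) (fun n' hn' => hLm n' (by omega)) M x (by
      rcases ha with h | h
      · left
        refine h.trans (mul_le_mul_of_nonneg_right ?_ (norm_nonneg _))
        exact_mod_cast le_max_right m a
      · right; omega)
  simp only [Finset.univ_unique, Finset.sum_singleton] at htail
  rw [sum_Ioc_split _ (le_max_left m a) M]
  have hnear : ‖∑ j ∈ Finset.Ioc m (min M (max m a)), d j * (Real.sin (j * x) : ℂ)‖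
      ≤ 21 * ε := by
    have hsplit : ∑ j ∈ Finset.Ioc m (min M (max m a)), d j * (Real.sin (j * x) : ℂ)
        = ∑ j ∈ Finset.Ioc m (min M (max m a)), d j * (pointSin r l j : ℂ)
          + ∑ j ∈ Finset.Ioc m (min M (max m a)),
              d j * ((Real.sin (j * x) - pointSin r l j : ℝ) : ℂ) := by
      rw [← Finset.sum_add_distrib]
      refine Finset.sum_congr rfl fun j _ => ?_
      push_cast; ring
    have herr : ‖∑ j ∈ Finset.Ioc m (min M (max m a)),
        d j * ((Real.sin (j * x) - pointSin r l j : ℝ) : ℂ)‖ ≤ 20 * ε := by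
      rcases le_total a m with ham | ham
      · rw [max_eq_left ham, Finset.Ioc_eq_empty_of_le (min_le_right _ _)]
        simp; positivity
      rw [max_eq_right ham]
      have hterm : ∀ j ∈ Finset.Ioc m (min M a),
          ‖d j * ((Real.sin (j * x) - pointSin r l j : ℝ) : ℂ)‖ ≤ 2 * ε * t := by
        intro j hj
        rw [Finset.mem_Ioc] at hj
        have h1 := mul_le_of_weight_le (by omega) (norm_nonneg _) (hK₀ j (by omega))
        rw [norm_mul, Complex.norm_real, Real.norm_eq_abs]
        calc ‖d j‖ * _ ≤ ‖d j‖ * (j * t) := by gcongr; exact htx j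
          _ = j * ‖d j‖ * t := by ring
          _ ≤ 2 * ε * t := by gcongr
      refine (norm_sum_le _ _).trans ((Finset.sum_le_card_nsmul _ _ _ hterm).trans ?_)
      rw [nsmul_eq_mul, Nat.card_Ioc]
      have hcard : ((min M a - m : ℕ) : ℝ) ≤ a := by exact_mod_cast (by omega : min M a - m ≤ a)
      calc _ ≤ (a : ℝ) * (2 * ε * t) := by gcongr
        _ = 2 * ε * (a * t) := by ring
        _ ≤ 2 * ε * 10 := by gcongr; norm_num at hat ⊢; linarith
        _ = 20 * ε := by ring
    rw [hsplit]
    refine (norm_add_le _ _).trans ?_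
    linarith [hpm l (Finset.mem_range.2 hl) (min M (max m a))]
  calc _ ≤ 21 * ε + G * ε := (norm_add_le _ _).trans (add_le_add hnear htail)
    _ = ε' := by rw [hεdef]; field_simp; ring

/-- The rectangle `m < j ≤ M`, `1 < k ≤ N` below both cuts: the sines are replaced by their values
at the nearest points, at the cost of `j t + k s` per term. -/
lemma norm_sum_below_cuts_le {c : ℕ → ℕ → ℂ} {r l₁ l₂ m M N : ℕ} {ε t s x y : ℝ}
    (hm : 1 ≤ m) (ht : 0 ≤ t) (hs : 0 ≤ s)
    (hx : ∀ j : ℕ, |Real.sin (j * x) - pointSin r l₁ j| ≤ j * t)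
    (hy : ∀ k : ℕ, |Real.sin (k * y) - pointSin r l₂ k| ≤ k * s)
    (hrow : ∀ j : ℕ, m < j → j * Real.log j * ∑ k ∈ Finset.Ioc 1 N, ‖c j k‖ ≤ ε)
    (hcol : ∀ k : ℕ, 1 < k → k * Real.log k * ∑ j ∈ Finset.Ioc m M, ‖c j k‖ ≤ ε) :
    ‖∑ j ∈ Finset.Ioc m M, ∑ k ∈ Finset.Ioc 1 N, doubleSineTerm c j k (x, y)‖ ≤
      ‖∑ j ∈ Finset.Ioc m M, ∑ k ∈ Finset.Ioc 1 N,
          c j k * (pointSin r l₁ j : ℂ) * (pointSin r l₂ k : ℂ)‖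
        + 2 * ε * (M * t) + 2 * ε * (N * s) := by
  have hε : 0 ≤ ε := by
    refine le_trans ?_ (hrow (m + 1) (by omega))
    exact mul_nonneg (mul_nonneg (Nat.cast_nonneg _) (Real.log_natCast_nonneg _))
      (Finset.sum_nonneg fun _ _ => norm_nonneg _)
  have hterm : ∀ j k, ‖doubleSineTerm c j k (x, y)
      - c j k * (pointSin r l₁ j : ℂ) * (pointSin r l₂ k : ℂ)‖ ≤ ‖c j k‖ * (j * t + k * s) := by
    intro j k
    have h1 : doubleSineTerm c j k (x, y) - c j k * (pointSin r l₁ j : ℂ) * (pointSin r l₂ k : ℂ)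
        = c j k * ((Real.sin (j * x) - pointSin r l₁ j) * Real.sin (k * y)
          + pointSin r l₁ j * (Real.sin (k * y) - pointSin r l₂ k) : ℝ) := by
      simp only [doubleSineTerm]; push_cast; ring
    rw [h1, norm_mul, Complex.norm_real, Real.norm_eq_abs]
    refine mul_le_mul_of_nonneg_left ((abs_add_le _ _).trans (add_le_add ?_ ?_)) (norm_nonneg _)
    · rw [abs_mul]
      exact (mul_le_of_le_one_right (abs_nonneg _) (Real.abs_sin_le_one _)).trans (hx j)
    · rw [abs_mul]
      exact (mul_le_of_le_one_left (abs_nonneg _) (abs_pointSin_le_one _ _ _)).trans (hy k)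
  have hsum : ∑ j ∈ Finset.Ioc m M, ∑ k ∈ Finset.Ioc 1 N, ‖c j k‖ * (j * t + k * s)
      ≤ 2 * ε * (M * t) + 2 * ε * (N * s) := by
    have e : ∑ j ∈ Finset.Ioc m M, ∑ k ∈ Finset.Ioc 1 N, ‖c j k‖ * (j * t + k * s)
        = ∑ j ∈ Finset.Ioc m M, (j * ∑ k ∈ Finset.Ioc 1 N, ‖c j k‖) * t
          + ∑ k ∈ Finset.Ioc 1 N, (k * ∑ j ∈ Finset.Ioc m M, ‖c j k‖) * s := by
      simp only [mul_add, Finset.sum_add_distrib, Finset.mul_sum, Finset.sum_mul]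
      congr 1
      · exact Finset.sum_congr rfl fun j _ => Finset.sum_congr rfl fun k _ => by ring
      · rw [Finset.sum_comm]
        exact Finset.sum_congr rfl fun j _ => Finset.sum_congr rfl fun k _ => by ring
    rw [e]
    refine add_le_add ?_ ?_
    · have h : ∀ j ∈ Finset.Ioc m M, (j * ∑ k ∈ Finset.Ioc 1 N, ‖c j k‖) * t ≤ 2 * ε * t := by
        intro j hj
        rw [Finset.mem_Ioc] at hj
        exact mul_le_mul_of_nonneg_right (mul_le_of_weight_le (by omega)
          (Finset.sum_nonneg fun _ _ => norm_nonneg _) (hrow j hj.1)) ht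
      refine (Finset.sum_le_card_nsmul _ _ _ h).trans ?_
      rw [nsmul_eq_mul, Nat.card_Ioc]
      have hcard : ((M - m : ℕ) : ℝ) ≤ M := by exact_mod_cast Nat.sub_le M m
      calc _ ≤ (M : ℝ) * (2 * ε * t) := by gcongr
        _ = _ := by ring
    · have h : ∀ k ∈ Finset.Ioc 1 N, (k * ∑ j ∈ Finset.Ioc m M, ‖c j k‖) * s ≤ 2 * ε * s := by
        intro k hk
        rw [Finset.mem_Ioc] at hk
        exact mul_le_mul_of_nonneg_right (mul_le_of_weight_le (by omega)
          (Finset.sum_nonneg fun _ _ => norm_nonneg _) (hcol k hk.1)) hs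
      refine (Finset.sum_le_card_nsmul _ _ _ h).trans ?_
      rw [nsmul_eq_mul, Nat.card_Ioc]
      have hcard : ((N - 1 : ℕ) : ℝ) ≤ N := by exact_mod_cast Nat.sub_le N 1
      calc _ ≤ (N : ℝ) * (2 * ε * s) := by gcongr
        _ = _ := by ring
  have hsplit : ∑ j ∈ Finset.Ioc m M, ∑ k ∈ Finset.Ioc 1 N, doubleSineTerm c j k (x, y)
      = ∑ j ∈ Finset.Ioc m M, ∑ k ∈ Finset.Ioc 1 N,
          c j k * (pointSin r l₁ j : ℂ) * (pointSin r l₂ k : ℂ)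
        + ∑ j ∈ Finset.Ioc m M, ∑ k ∈ Finset.Ioc 1 N, (doubleSineTerm c j k (x, y)
          - c j k * (pointSin r l₁ j : ℂ) * (pointSin r l₂ k : ℂ)) := by
    simp only [← Finset.sum_add_distrib, add_sub_cancel]
  rw [hsplit, add_assoc]
  refine (norm_add_le _ _).trans (add_le_add le_rfl (le_trans ?_ hsum))
  refine (norm_sum_le _ _).trans (Finset.sum_le_sum fun j _ => ?_)
  exact (norm_sum_le _ _).trans (Finset.sum_le_sum fun k _ => hterm j k)

lemma sum_Icc_one_eq {E : Type*} [AddCommGroup E] (f : ℕ → E) {N : ℕ} (hN : 1 ≤ N) :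
    ∑ k ∈ Finset.Ioc 1 N, f k = ∑ k ∈ Finset.Icc 1 N, f k - f 1 := by
  rw [sum_Icc_eq_add_Ioc f hN]; simp

/-- The strip `m < j ≤ M`, `k ≤ N` of the double sine series is small for large `m`, uniformly in
`M`, `N`, `x`, `y`. Beyond the cut for `x`, `sum_norm_sine_tail_le` applies in `j` to the family of
columns; beyond the cut for `y`, it applies in `k` to the family of rows; below both cuts,
`norm_sum_below_cuts_le` applies. The column `k = 1`, whose absolute sum may be infinite, is treated
separately. -/
theorem eventually_norm_sum_strip_le {p : ℝ} {r : ℕ} (hp : 1 < p) (hr : 1 ≤ r) {c : ℕ → ℕ → ℂ}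
    (hv₁ : HasColumnVariation p r c) (hv₂ : HasColumnVariation p r (fun j k => c k j))
    (ht₁ : HasLogTails c) (ht₂ : HasLogTails (fun j k => c k j))
    (hpt : ∀ l₁ < r, ∀ l₂ < r, RegularlyConvergent
      (fun j k => c j k * (pointSin r l₁ j : ℂ) * (pointSin r l₂ k : ℂ)))
    (hcol : ∀ ε > 0, ∀ᶠ m in atTop, ∀ (M : ℕ) (x : ℝ),
      ‖∑ j ∈ Finset.Ioc m M, c j 1 * (Real.sin (j * x) : ℂ)‖ ≤ ε)
    {ε' : ℝ} (hε' : 0 < ε') :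
    ∀ᶠ m in atTop, ∀ (M N : ℕ) (z : ℝ × ℝ),
      ‖∑ j ∈ Finset.Ioc m M, ∑ k ∈ Finset.Icc 1 N, doubleSineTerm c j k z‖ ≤ ε' := by
  obtain ⟨C₁, Λ₁, n₁, L₁, hC₁, hL₁, hv₁⟩ := hv₁
  obtain ⟨C₂, Λ₂, n₂, L₂, hC₂, hL₂, hv₂⟩ := hv₂
  obtain ⟨q, hq⟩ := exists_nat_ge p
  set G₁ := tailConst p r q C₁ Λ₁ with hG₁
  have hG₁0 : 0 ≤ G₁ := tailConst_nonneg (by linarith) r q hC₁ Λ₁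
  set G₂ := tailConst p r q C₂ Λ₂ with hG₂
  have hG₂0 : 0 ≤ G₂ := tailConst_nonneg (by linarith) r q hC₂ Λ₂
  obtain ⟨K₂', hK₂'⟩ := eventually_atTop.1 (hL₂.eventually_gt_atTop 1)
  set K₂ := max K₂' (max 2 n₂) with hK₂
  set A : ℝ := G₁ + G₂ + 2 * 10 + 2 * (4 * K₂ + 6) + 3 with hA
  have hApos : 0 < A := by positivity
  set ε := ε' / A with hεdef
  have hε : 0 < ε := by positivity
  obtain ⟨Kr, hKr⟩ := ht₁ ε hε
  obtain ⟨Kc, hKc⟩ := ht₂ ε hε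
  set K := max Kr 1 with hKdef
  have hpts : ∀ᶠ m in atTop, ∀ l₁ ∈ Finset.range r, ∀ l₂ ∈ Finset.range r, ∀ M N,
      ‖∑ j ∈ Finset.Ioc m M, ∑ k ∈ Finset.Icc 1 N,
        c j k * (pointSin r l₁ j : ℂ) * (pointSin r l₂ k : ℂ)‖ ≤ ε := by
    rw [Filter.eventually_all_finset]
    intro l₁ hl₁
    rw [Filter.eventually_all_finset]
    exact fun l₂ hl₂ =>
      (hpt l₁ (Finset.mem_range.1 hl₁) l₂ (Finset.mem_range.1 hl₂)).eventually_strip hε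
  have hLev : ∀ᶠ m in atTop, ∀ n', m ≤ n' → K < L₁ n' :=
    eventually_forall_ge_atTop.2 (hL₁.eventually_gt_atTop K)
  filter_upwards [hpts, hcol ε hε, hLev, eventually_ge_atTop (max K (max 2 (max n₁ Kc)))]
    with m hpm hcm hLm hm M N z
  obtain ⟨x, y⟩ := z
  simp only [max_le_iff] at hm
  have hrow : ∀ j : ℕ, K < j → ∀ N, j * Real.log j * ∑ k ∈ Finset.Ioc 1 N, ‖c j k‖ ≤ ε := by
    intro j hj N
    have h := hKr j 1 (by omega) le_rfl (by omega) j le_rfl (N + 1)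
    refine le_trans ?_ h
    refine mul_le_mul_of_nonneg_left ?_
      (mul_nonneg (Nat.cast_nonneg _) (Real.log_natCast_nonneg _))
    refine Finset.sum_le_sum_of_subset_of_nonneg (fun k hk => ?_) fun _ _ _ => norm_nonneg _
    simp only [Finset.mem_Ioc, Finset.mem_Ico] at hk ⊢
    omega
  have hcols : ∀ k : ℕ, 1 < k → ∀ M, k * Real.log k * ∑ j ∈ Finset.Ioc m M, ‖c j k‖ ≤ ε := by
    intro k hk M
    have h := hKc 1 (m + 1) le_rfl (by omega) (by omega) k hk.le (M + 1)
    have e : Finset.Ico (m + 1) (M + 1) = Finset.Ioc m M := by ext; simp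
    rwa [e] at h
  rcases Nat.eq_zero_or_pos N with rfl | hN
  · simpa using hε'.le
  obtain ⟨l₁, hl₁, t, ht0, ht4, htx, htδ⟩ := exists_nearest_point hr x
  obtain ⟨a, -, hat, ha⟩ := exists_cut ht0 ht4 htδ 1 M
  obtain ⟨l₂, hl₂, s, hs0, hs4, hsy, hsδ⟩ := exists_nearest_point hr y
  obtain ⟨b, hbK, hbs, hb⟩ := exists_cut hs0 hs4 hsδ K₂ N
  -- the column `k = 1`
  have hone : ‖∑ j ∈ Finset.Ioc m M, doubleSineTerm c j 1 (x, y)‖ ≤ ε := by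
    have e : ∑ j ∈ Finset.Ioc m M, doubleSineTerm c j 1 (x, y)
        = (∑ j ∈ Finset.Ioc m M, c j 1 * (Real.sin (j * x) : ℂ))
          * (Real.sin ((1 : ℕ) * y) : ℂ) := by
      rw [Finset.sum_mul]; rfl
    rw [e]
    exact (norm_mul_ofReal_le _ (Real.abs_sin_le_one _)).trans (hcm M x)
  -- beyond the cut for `x`
  have hfarx : ‖∑ j ∈ Finset.Ioc (max m a) M, ∑ k ∈ Finset.Ioc 1 N, doubleSineTerm c j k (x, y)‖
      ≤ G₁ * ε := by
    have h := sum_norm_sine_tail_le (Finset.Ioc 1 N) (fun k j => c j k) (K := K)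
      (n := max m a) hp hq hε.le hC₁ (fun j hj => hrow j hj N)
      (fun k hk => hv₁ k (Finset.mem_Ioc.1 hk).1.le) (by omega) (by omega) (by omega)
      (by omega) (fun n' hn' => hLm n' (by omega)) M x (by
        rcases ha with h | h
        · left
          refine h.trans (mul_le_mul_of_nonneg_right ?_ (norm_nonneg _))
          exact_mod_cast le_max_right m a
        · right; omega)
    refine le_trans ?_ h
    rw [Finset.sum_comm]
    refine (norm_sum_le _ _).trans (Finset.sum_le_sum fun k _ => ?_)
    simp only [doubleSineTerm]
    rw [← Finset.sum_mul]
    exact norm_mul_ofReal_le _ (Real.abs_sin_le_one _)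
  -- below the cut for `x`, beyond the cut for `y`
  have hfary : ∀ M', ‖∑ j ∈ Finset.Ioc m M', ∑ k ∈ Finset.Ioc b N, doubleSineTerm c j k (x, y)‖
      ≤ G₂ * ε := by
    intro M'
    have h := sum_norm_sine_tail_le (Finset.Ioc m M') (fun j k => c j k) (K := 1)
      (n := b) hp hq hε.le hC₂ (fun k hk => hcols k hk M')
      (fun j hj => hv₂ j (by have := (Finset.mem_Ioc.1 hj).1; omega)) le_rfl (by omega) (by omega)
      (by omega) (fun n' hn' => hK₂' n' (by omega)) N y hb
    refine le_trans ?_ h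
    refine (norm_sum_le _ _).trans (Finset.sum_le_sum fun j _ => ?_)
    have e : ∑ k ∈ Finset.Ioc b N, doubleSineTerm c j k (x, y)
        = (∑ k ∈ Finset.Ioc b N, c j k * (Real.sin (k * y) : ℂ)) * (Real.sin (j * x) : ℂ) := by
      rw [Finset.sum_mul]
      exact Finset.sum_congr rfl fun k _ => by simp only [doubleSineTerm]; ring
    rw [e]
    exact norm_mul_ofReal_le _ (Real.abs_sin_le_one _)
  -- below both cuts
  have hnear : ‖∑ j ∈ Finset.Ioc m (min M (max m a)), ∑ k ∈ Finset.Ioc 1 (min N b),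
      doubleSineTerm c j k (x, y)‖ ≤ (2 * 10 + 2 * (4 * K₂ + 6) + 2) * ε := by
    have hempty : max m a = m ∨ max m a = a := max_choice m a
    rcases hempty with h | h
    · rw [h, Finset.Ioc_eq_empty_of_le (min_le_right _ _)]
      simp only [Finset.sum_empty, norm_zero]
      positivity
    rw [h]
    have hb1 : 1 ≤ min N b := by omega
    have hmain := norm_sum_below_cuts_le (c := c) (r := r) (l₁ := l₁) (l₂ := l₂) (m := m)
      (M := min M a) (N := min N b) (ε := ε) (by omega) ht0 hs0 htx hsy
      (fun j hj => hrow j (by omega) _) (fun k hk => hcols k hk _)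
    have hpoint : ‖∑ j ∈ Finset.Ioc m (min M a), ∑ k ∈ Finset.Ioc 1 (min N b),
        c j k * (pointSin r l₁ j : ℂ) * (pointSin r l₂ k : ℂ)‖ ≤ 2 * ε := by
      have e : ∑ j ∈ Finset.Ioc m (min M a), ∑ k ∈ Finset.Ioc 1 (min N b),
            c j k * (pointSin r l₁ j : ℂ) * (pointSin r l₂ k : ℂ)
          = ∑ j ∈ Finset.Ioc m (min M a), ∑ k ∈ Finset.Icc 1 (min N b),
              c j k * (pointSin r l₁ j : ℂ) * (pointSin r l₂ k : ℂ)
            - ∑ j ∈ Finset.Ioc m (min M a), ∑ k ∈ Finset.Icc 1 1,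
              c j k * (pointSin r l₁ j : ℂ) * (pointSin r l₂ k : ℂ) := by
        rw [← Finset.sum_sub_distrib]
        refine Finset.sum_congr rfl fun j _ => ?_
        rw [sum_Icc_one_eq _ hb1]; simp
      rw [e]
      have h1 := hpm l₁ (Finset.mem_range.2 hl₁) l₂ (Finset.mem_range.2 hl₂)
      refine (norm_sub_le _ _).trans ((add_le_add (h1 _ _) (h1 _ _)).trans_eq (by ring))
    have hMt : ((min M a : ℕ) : ℝ) * t ≤ 10 := by
      have : ((min M a : ℕ) : ℝ) ≤ a := by exact_mod_cast min_le_right M a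
      have h3 := mul_le_mul_of_nonneg_right this ht0
      norm_num at hat
      linarith
    have hNs : ((min N b : ℕ) : ℝ) * s ≤ 4 * K₂ + 6 := by
      have : ((min N b : ℕ) : ℝ) ≤ b := by exact_mod_cast min_le_right N b
      have h3 := mul_le_mul_of_nonneg_right this hs0
      linarith
    have h4 := mul_le_mul_of_nonneg_left hMt (by positivity : 0 ≤ 2 * ε)
    have h5 := mul_le_mul_of_nonneg_left hNs (by positivity : 0 ≤ 2 * ε)
    linarith
  have hdecomp : ∑ j ∈ Finset.Ioc m M, ∑ k ∈ Finset.Icc 1 N, doubleSineTerm c j k (x, y)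
      = ∑ j ∈ Finset.Ioc m M, doubleSineTerm c j 1 (x, y)
        + ((∑ j ∈ Finset.Ioc m (min M (max m a)), ∑ k ∈ Finset.Ioc 1 (min N b),
              doubleSineTerm c j k (x, y)
            + ∑ j ∈ Finset.Ioc m (min M (max m a)), ∑ k ∈ Finset.Ioc b N,
              doubleSineTerm c j k (x, y))
          + ∑ j ∈ Finset.Ioc (max m a) M, ∑ k ∈ Finset.Ioc 1 N, doubleSineTerm c j k (x, y)) := by
    have e : ∀ j, ∑ k ∈ Finset.Icc 1 N, doubleSineTerm c j k (x, y)
        = doubleSineTerm c j 1 (x, y) + ∑ k ∈ Finset.Ioc 1 N, doubleSineTerm c j k (x, y) :=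
      fun j => by rw [sum_Icc_one_eq _ hN]; ring
    rw [Finset.sum_congr rfl fun j _ => e j, Finset.sum_add_distrib,
      sum_Ioc_split (fun j => ∑ k ∈ Finset.Ioc 1 N, doubleSineTerm c j k (x, y))
        (le_max_left m a) M, ← Finset.sum_add_distrib]
    congr 2
    exact Finset.sum_congr rfl fun j _ => sum_Ioc_split _ (by omega) N
  rw [hdecomp]
  calc _ ≤ ε + (((2 * 10 + 2 * (4 * K₂ + 6) + 2) * ε + G₂ * ε) + G₁ * ε) :=
        (norm_add_le _ _).trans (add_le_add hone ((norm_add_le _ _).trans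
          (add_le_add ((norm_add_le _ _).trans (add_le_add hnear (hfary _))) hfarx)))
    _ = A * ε := by rw [hA]; ring
    _ = ε' := mul_div_cancel₀ _ hApos.ne'

/-! ### The class `DGM` and the tail conditions in terms of finite real sums -/

lemma sum_enorm_eq_ofReal {ι : Type*} (s : Finset ι) (f : ι → ℂ) :
    ∑ i ∈ s, ‖f i‖ₑ = ENNReal.ofReal (∑ i ∈ s, ‖f i‖) := by
  rw [ENNReal.ofReal_sum_of_nonneg fun _ _ => norm_nonneg _]
  simp only [ofReal_norm]

/-- Hölder's inequality on `[n, 2n)` turns the `ℓᵖ` bound of the class into an `ℓ¹` bound. The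
maximum over `b ≤ M ≤ λ b` is at most the sum over the single window from `⌈b⌉` to `2 λ ⌈b⌉`. -/
lemma sum_block_le_of_dgm {p C b : ℝ} {r lam n : ℕ} {d : ℕ → ℂ} (hp : 1 < p) (hC : 0 ≤ C)
    (hn : 1 ≤ n)
    (h : (∑ j ∈ Finset.Ico n (2 * n), ‖d j - d (j + r)‖ₑ ^ p) ^ (1 / p) ≤
      ENNReal.ofReal C * ((n : ℝ≥0∞)⁻¹ * ⨆ (M : ℕ) (_ : 1 ≤ M ∧ b ≤ M ∧ (M : ℝ) ≤ lam * b),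
        ∑ j ∈ Finset.Icc M (2 * M), ‖d j‖ₑ)) :
    ∑ j ∈ Finset.Ico n (2 * n), ‖d j - d (j + r)‖
      ≤ C * (n : ℝ) ^ (-(1 / p)) * ∑ j ∈ Finset.Icc ⌈b⌉₊ (2 * lam * ⌈b⌉₊), ‖d j‖ := by
  have hp0 : 0 < p := by linarith
  have hn0 : (0 : ℝ) < n := by exact_mod_cast hn
  set W := ∑ j ∈ Finset.Icc ⌈b⌉₊ (2 * lam * ⌈b⌉₊), ‖d j‖ with hW
  have hW0 : 0 ≤ W := Finset.sum_nonneg fun _ _ => norm_nonneg _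
  set X := ∑ j ∈ Finset.Ico n (2 * n), ‖d j - d (j + r)‖ ^ p with hX
  have hX0 : 0 ≤ X := Finset.sum_nonneg fun _ _ => by positivity
  set V := ∑ j ∈ Finset.Ico n (2 * n), ‖d j - d (j + r)‖ with hV
  have hV0 : 0 ≤ V := Finset.sum_nonneg fun _ _ => norm_nonneg _
  have hsup : (⨆ (M : ℕ) (_ : 1 ≤ M ∧ b ≤ M ∧ (M : ℝ) ≤ lam * b),
      ∑ j ∈ Finset.Icc M (2 * M), ‖d j‖ₑ) ≤ ENNReal.ofReal W := by
    refine iSup₂_le fun M hM => ?_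
    obtain ⟨-, hbM, hMb⟩ := hM
    rw [sum_enorm_eq_ofReal]
    refine ENNReal.ofReal_le_ofReal (Finset.sum_le_sum_of_subset_of_nonneg (fun j hj => ?_)
      fun _ _ _ => norm_nonneg _)
    rw [Finset.mem_Icc] at hj ⊢
    have h1 : ⌈b⌉₊ ≤ M := Nat.ceil_le.2 hbM
    have h2 : M ≤ lam * ⌈b⌉₊ := by
      have : (M : ℝ) ≤ lam * (⌈b⌉₊ : ℕ) := hMb.trans (by gcongr; exact Nat.le_ceil b)
      exact_mod_cast this
    refine ⟨h1.trans hj.1, hj.2.trans ?_⟩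
    rw [mul_assoc]; omega
  have hlhs : (∑ j ∈ Finset.Ico n (2 * n), ‖d j - d (j + r)‖ₑ ^ p) ^ (1 / p)
      = ENNReal.ofReal (X ^ (1 / p)) := by
    rw [← ENNReal.ofReal_rpow_of_nonneg hX0 (by positivity), hX,
      ENNReal.ofReal_sum_of_nonneg fun _ _ => by positivity]
    congr 1
    refine Finset.sum_congr rfl fun j _ => ?_
    rw [← ENNReal.ofReal_rpow_of_nonneg (norm_nonneg _) hp0.le, ofReal_norm]
  have hXW : X ^ (1 / p) ≤ C * ((n : ℝ)⁻¹ * W) := by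
    rw [hlhs] at h
    rw [← ENNReal.ofReal_le_ofReal_iff (by positivity), ENNReal.ofReal_mul hC,
      ENNReal.ofReal_mul (by positivity), ENNReal.ofReal_inv_of_pos hn0, ENNReal.ofReal_natCast]
    exact h.trans (by gcongr)
  have hHolder : V ^ p ≤ (n : ℝ) ^ (p - 1) * X := by
    have := Real.rpow_sum_le_const_mul_sum_rpow (Finset.Ico n (2 * n))
      (fun j => ‖d j - d (j + r)‖) hp.le
    simp only [abs_norm, Nat.card_Ico] at this
    rwa [show 2 * n - n = n by omega] at this
  have hVX : V ≤ (n : ℝ) ^ (1 - 1 / p) * X ^ (1 / p) := by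
    have h1 := Real.rpow_le_rpow (by positivity) hHolder (by positivity : 0 ≤ 1 / p)
    rw [← Real.rpow_mul hV0, mul_one_div_cancel hp0.ne', Real.rpow_one,
      Real.mul_rpow (by positivity) hX0, ← Real.rpow_mul hn0.le] at h1
    rwa [show (p - 1) * (1 / p) = 1 - 1 / p by field_simp] at h1
  calc V ≤ (n : ℝ) ^ (1 - 1 / p) * (C * ((n : ℝ)⁻¹ * W)) := hVX.trans (by gcongr)
    _ = C * ((n : ℝ) ^ (1 - 1 / p) * (n : ℝ)⁻¹) * W := by ring
    _ = _ := by
      rw [← Real.rpow_neg_one, ← Real.rpow_add hn0]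
      congr 3
      ring

lemma hasColumnVariation_of_dgm {p C : ℝ} {r lam lam' : ℕ} {c : ℕ → ℕ → ℂ} {b : ℕ → ℝ}
    (hp : 1 < p) (hC : 0 ≤ C) (hlam' : 1 ≤ lam') (hb : Tendsto b atTop atTop)
    (h : ∀ m n : ℕ, lam' ≤ m → 1 ≤ n →
      (∑ j ∈ Finset.Ico m (2 * m), ‖deltaRow r c j n‖ₑ ^ p) ^ (1 / p)
        ≤ ENNReal.ofReal C * alphaTwo c lam b m n) :
    HasColumnVariation p r c :=
  ⟨C, 2 * lam, lam', fun n => ⌈b n⌉₊, hC, tendsto_nat_ceil_atTop.comp hb,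
    fun k hk n hn => sum_block_le_of_dgm hp hC (hlam'.trans hn) (h n k hn hk)⟩

lemma eventually_sumAtTop {P : ℕ × ℕ → Prop} (h : ∀ᶠ q in sumAtTop, P q) :
    ∃ K : ℕ, ∀ m n, 1 ≤ m → 1 ≤ n → K ≤ m + n → P (m, n) := by
  rw [sumAtTop, eventually_inf_principal, eventually_comap] at h
  obtain ⟨K, hK⟩ := eventually_atTop.1 h
  exact ⟨K, fun m n hm hn hmn => hK (m + n) hmn (m, n) rfl ⟨hm, hn⟩⟩

lemma mul_sum_Ico_le_of_tsum_le {w ε : ℝ} {f : ℕ → ℂ} {n : ℕ} (hw : 0 ≤ w) (hε : 0 ≤ ε)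
    (h : ENNReal.ofReal w * ∑' i : ℕ, ‖f (n + i)‖ₑ ≤ ENNReal.ofReal ε) (N : ℕ) :
    w * ∑ k ∈ Finset.Ico n N, ‖f k‖ ≤ ε := by
  rw [← ENNReal.ofReal_le_ofReal_iff hε, ENNReal.ofReal_mul hw, ← sum_enorm_eq_ofReal,
    Finset.sum_Ico_eq_sum_range]
  exact (by gcongr; exact ENNReal.sum_le_tsum _ : _ ≤ _).trans h

lemma tendsto_swap_sumAtTop : Tendsto Prod.swap sumAtTop sumAtTop := by
  rw [sumAtTop]
  refine tendsto_inf.2 ⟨tendsto_comap_iff.2 ?_, tendsto_principal.2 ?_⟩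
  · refine (tendsto_comap.mono_left inf_le_left).congr fun q => ?_
    simp [add_comm]
  · exact eventually_inf_principal.2 (Eventually.of_forall fun q hq => ⟨hq.2, hq.1⟩)

lemma hasLogTails_of_tendsto {c : ℕ → ℕ → ℂ}
    (h : Tendsto (fun q : ℕ × ℕ => ⨆ (j : ℕ) (_ : q.1 ≤ j),
      ENNReal.ofReal (j * Real.log j) * ∑' i : ℕ, ‖c j (q.2 + i)‖ₑ) sumAtTop (𝓝 0)) :
    HasLogTails c := by
  intro ε hε
  obtain ⟨K, hK⟩ := eventually_sumAtTop
    (ENNReal.tendsto_nhds_zero.1 h (ENNReal.ofReal ε) (by simpa using hε))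
  refine ⟨K, fun m n hm hn hmn j hj N => ?_⟩
  exact mul_sum_Ico_le_of_tsum_le
    (mul_nonneg (Nat.cast_nonneg _) (Real.log_natCast_nonneg _)) hε.le
    ((le_iSup₂_of_le j hj le_rfl).trans (hK m n hm hn hmn)) N

/-! ### Convergence at the points `2 π l / r` -/

/-- By periodicity and oddness of the sine, `sin (2 π l j / r)` is, for `l < r`, either `0` for all
`j` or, up to sign, the value for an index between `1` and the number of points strictly inside
`(0, π)`. -/
lemma pointSin_cases {r l : ℕ} (hl : l < r) :
    (∀ j, pointSin r l j = 0) ∨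
    (3 ≤ r ∧ ∃ l' ∈ Finset.Icc 1 (if Even r then r / 2 - 1 else r / 2), ∃ e : ℝ,
      ∀ j, pointSin r l j = e * pointSin r l' j) := by
  have hr0 : (r : ℝ) ≠ 0 := by exact_mod_cast (by omega : r ≠ 0)
  rcases Nat.eq_zero_or_pos l with rfl | hl0
  · left; intro j; simp [pointSin]
  rcases lt_trichotomy (2 * l) r with h | h | h
  · refine Or.inr ⟨by omega, l, ?_, 1, fun j => (one_mul _).symm⟩
    rw [Finset.mem_Icc]
    refine ⟨hl0, ?_⟩
    split_ifs with he
    · obtain ⟨s, hs⟩ := he; omega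
    · omega
  · left
    intro j
    have h1 : (r : ℝ) = 2 * l := by exact_mod_cast h.symm
    have hl1 : (l : ℝ) ≠ 0 := by exact_mod_cast hl0.ne'
    have h2 : (j : ℝ) * (2 * (l : ℝ) * Real.pi / r) = j * Real.pi := by
      rw [h1]; field_simp
    rw [pointSin, h2, Real.sin_nat_mul_pi]
  · refine Or.inr ⟨by omega, r - l, ?_, -1, fun j => ?_⟩
    · rw [Finset.mem_Icc]
      refine ⟨by omega, ?_⟩
      split_ifs with he
      · obtain ⟨s, hs⟩ := he; omega
      · omega
    · have h2 : (j : ℝ) * (2 * ((r - l : ℕ) : ℝ) * Real.pi / r)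
          = j * (2 * Real.pi) - j * (2 * (l : ℝ) * Real.pi / r) := by
        rw [Nat.cast_sub hl.le]; field_simp
      rw [pointSin, pointSin, h2, Real.sin_nat_mul_two_pi_sub]
      ring

lemma RegularlyConvergent.const_mul {a : ℕ → ℕ → ℂ} (h : RegularlyConvergent a) (w : ℂ) :
    RegularlyConvergent (fun j k => w * a j k) := by
  obtain ⟨⟨s, hs⟩, h1, h2⟩ := h
  refine ⟨⟨w * s, ?_⟩, fun n hn => ?_, fun m hm => ?_⟩
  · simpa only [Finset.mul_sum] using hs.const_mul w
  · obtain ⟨s, hs⟩ := h1 n hn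
    exact ⟨w * s, by simpa only [Finset.mul_sum] using hs.const_mul w⟩
  · obtain ⟨s, hs⟩ := h2 m hm
    exact ⟨w * s, by simpa only [Finset.mul_sum] using hs.const_mul w⟩

lemma regularlyConvergent_zero : RegularlyConvergent (fun _ _ => 0) := by
  refine ⟨⟨0, ?_⟩, fun _ _ => ⟨0, ?_⟩, fun _ _ => ⟨0, ?_⟩⟩ <;> simp

/-- The double sine series converges regularly at `(2 π l₁ / r, 2 π l₂ / r)` for the indices of the
points strictly inside `(0, π)`. -/
def ConvergesAtPoints (r : ℕ) (c : ℕ → ℕ → ℂ) : Prop :=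
  3 ≤ r → ∀ l₁ ∈ Finset.Icc 1 (if Even r then r / 2 - 1 else r / 2),
    ∀ l₂ ∈ Finset.Icc 1 (if Even r then r / 2 - 1 else r / 2),
      RegularlyConvergent (fun j k => c j k * (pointSin r l₁ j : ℂ) * (pointSin r l₂ k : ℂ))

lemma ConvergesAtPoints.swap {r : ℕ} {c : ℕ → ℕ → ℂ} (h : ConvergesAtPoints r c) :
    ConvergesAtPoints r (fun j k => c k j) := by
  intro hr l₁ hl₁ l₂ hl₂
  convert (h hr l₂ hl₂ l₁ hl₁).swap using 3
  ring

lemma ConvergesAtPoints.regularlyConvergent {r : ℕ} {c : ℕ → ℕ → ℂ} (h : ConvergesAtPoints r c)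
    {l₁ l₂ : ℕ} (hl₁ : l₁ < r) (hl₂ : l₂ < r) :
    RegularlyConvergent (fun j k => c j k * (pointSin r l₁ j : ℂ) * (pointSin r l₂ k : ℂ)) := by
  rcases pointSin_cases hl₁ with h1 | ⟨hr, l₁', hl₁', e₁, h1⟩
  · simpa [h1] using regularlyConvergent_zero
  rcases pointSin_cases hl₂ with h2 | ⟨-, l₂', hl₂', e₂, h2⟩
  · simpa [h2] using regularlyConvergent_zero
  convert (h hr l₁' hl₁' l₂' hl₂').const_mul ((e₁ : ℂ) * e₂) using 3
  rw [h1, h2]; push_cast; ring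

/-- The column `k = 1` converges at the points, because `sin (2 π / r) ≠ 0` when `r ≥ 3`. -/
lemma ConvergesAtPoints.column_one {r : ℕ} {c : ℕ → ℕ → ℂ} (h : ConvergesAtPoints r c)
    {l : ℕ} (hl : l < r) :
    ∃ s, Tendsto (fun M : ℕ => ∑ j ∈ Finset.Icc 1 M, c j 1 * (pointSin r l j : ℂ)) atTop (𝓝 s) := by
  rcases pointSin_cases hl with h1 | ⟨hr, -⟩
  · exact ⟨0, by simp [h1]⟩
  obtain ⟨s, hs⟩ := (h.regularlyConvergent hl (by omega : 1 < r)).2.1 1 le_rfl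
  have hr3 : (3 : ℝ) ≤ r := by exact_mod_cast hr
  have hne : pointSin r 1 1 ≠ 0 := by
    have h0 : 0 < 2 * Real.pi / r := by have := Real.pi_pos; positivity
    have h2 : 2 * Real.pi / r < Real.pi := by
      rw [div_lt_iff₀ (by linarith)]; nlinarith [Real.pi_pos]
    have := Real.sin_pos_of_pos_of_lt_pi h0 h2
    simpa [pointSin] using this.ne'
  have hne' : (pointSin r 1 1 : ℂ) ≠ 0 := by exact_mod_cast hne
  refine ⟨s * (pointSin r 1 1 : ℂ)⁻¹, (hs.mul_const _).congr fun M => ?_⟩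
  rw [Finset.sum_mul]
  exact Finset.sum_congr rfl fun j _ => by field_simp

/-! ### Uniform regular convergence -/

lemma exists_tendstoUniformly_of_eventually_le {ι X : Type*} [SemilatticeSup ι] [Nonempty ι]
    {F : ι → X → ℂ}
    (h : ∀ ε > 0, ∃ K, ∀ q, K ≤ q → ∀ x, ‖F q x - F K x‖ ≤ ε) :
    ∃ S : X → ℂ, TendstoUniformly F S atTop := by
  have hu : UniformCauchySeqOn F atTop Set.univ := by
    rw [Metric.uniformCauchySeqOn_iff]
    intro ε hε
    obtain ⟨K, hK⟩ := h (ε / 3) (by positivity)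
    refine ⟨K, fun m hm n hn x _ => ?_⟩
    have h1 := hK m hm x
    have h2 := hK n hn x
    rw [← dist_eq_norm] at h1 h2
    linarith [dist_triangle_right (F m x) (F n x) (F K x)]
  choose S hS using fun x =>
    cauchySeq_tendsto_of_complete (hu.cauchySeq (Set.mem_univ x))
  exact ⟨S, tendstoUniformlyOn_univ.1 (hu.tendstoUniformlyOn_of_tendsto fun x _ => hS x)⟩

lemma exists_tendstoUniformly_series {X : Type*} {f : ℕ → X → ℂ}
    (h : ∀ ε > 0, ∀ᶠ m in atTop, ∀ (M : ℕ) (x : X), ‖∑ j ∈ Finset.Ioc m M, f j x‖ ≤ ε) :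
    ∃ S : X → ℂ, TendstoUniformly (fun (M : ℕ) x => ∑ j ∈ Finset.Icc 1 M, f j x) S atTop := by
  refine exists_tendstoUniformly_of_eventually_le fun ε hε => ?_
  obtain ⟨K, hK⟩ := (h ε hε).exists
  refine ⟨K, fun M hM x => ?_⟩
  rw [sum_Icc_eq_add_Ioc _ hM, add_sub_cancel_left]
  exact hK M x

/-- Column variation, both tail conditions and convergence at the points. Together with the same
for the transposed sequence this is all that uniform regular convergence needs. -/
structure SineConditions (p : ℝ) (r : ℕ) (c : ℕ → ℕ → ℂ) : Prop where
  variation : HasColumnVariation p r c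
  rowTails : HasLogTails c
  colTails : HasLogTails (fun j k => c k j)
  points : ConvergesAtPoints r c

/-- Sine sums of a fixed column are uniformly small far out. For `k ≥ 2` the column is absolutely
summable; for `k = 1` this is the one-dimensional case. -/
lemma SineConditions.eventually_column {p : ℝ} {r : ℕ} {c : ℕ → ℕ → ℂ} (hp : 1 < p) (hr : 1 ≤ r)
    (h : SineConditions p r c) {n : ℕ} (hn : 1 ≤ n) {ε : ℝ} (hε : 0 < ε) :
    ∀ᶠ m in atTop, ∀ (M : ℕ) (x : ℝ),
      ‖∑ j ∈ Finset.Ioc m M, c j n * (Real.sin (j * x) : ℂ)‖ ≤ ε := by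
  rcases hn.eq_or_lt with rfl | hn2
  · obtain ⟨C, Λ, n₀, L, hC, hL, hv⟩ := h.variation
    refine eventually_norm_sum_sin_le hp hr hC hL (hv 1 le_rfl) (fun ε hε => ?_)
      (fun l hl => h.points.column_one hl) hε
    obtain ⟨K, hK⟩ := h.rowTails ε hε
    exact ⟨K, fun j hj => by simpa using hK j 1 (by omega) le_rfl (by omega) j le_rfl 2⟩
  · obtain ⟨K, hK⟩ := h.colTails (ε / 2) (by positivity)
    filter_upwards [eventually_ge_atTop K] with m hm M x
    have h1 := hK 1 (m + 1) le_rfl (by omega) (by omega) n hn (M + 1)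
    have h2 := mul_le_of_weight_le hn2 (Finset.sum_nonneg fun _ _ => norm_nonneg _) h1
    have e : Finset.Ico (m + 1) (M + 1) = Finset.Ioc m M := by ext; simp
    rw [e] at h2
    have h3 : (1 : ℝ) ≤ n := by exact_mod_cast hn
    have h4 : 0 ≤ ∑ j ∈ Finset.Ioc m M, ‖c j n‖ := Finset.sum_nonneg fun _ _ => norm_nonneg _
    refine (norm_sum_le _ _).trans ((Finset.sum_le_sum fun j _ =>
      norm_mul_ofReal_le _ (Real.abs_sin_le_one _)).trans ?_)
    nlinarith

lemma doubleSineTerm_swap (c : ℕ → ℕ → ℂ) (j k : ℕ) (z : ℝ × ℝ) :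
    doubleSineTerm (fun j k => c k j) k j z.swap = doubleSineTerm c j k z := by
  simp only [doubleSineTerm, Prod.fst_swap, Prod.snd_swap]; ring

lemma SineConditions.exists_tendstoUniformly_column {p : ℝ} {r : ℕ} {c : ℕ → ℕ → ℂ} (hp : 1 < p)
    (hr : 1 ≤ r) (h : SineConditions p r c) {n : ℕ} (hn : 1 ≤ n) :
    ∃ S : ℝ × ℝ → ℂ, TendstoUniformly
      (fun (M : ℕ) z => ∑ j ∈ Finset.Icc 1 M, doubleSineTerm c j n z) S atTop := by
  refine exists_tendstoUniformly_series fun ε hε => ?_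
  filter_upwards [h.eventually_column hp hr hn hε] with m hm M z
  simp only [doubleSineTerm]
  rw [← Finset.sum_mul]
  exact (norm_mul_ofReal_le _ (Real.abs_sin_le_one _)).trans (hm M z.1)

theorem SineConditions.uniformlyRegularlyConvergent {p : ℝ} {r : ℕ} {c : ℕ → ℕ → ℂ} (hp : 1 < p)
    (hr : 1 ≤ r) (h₁ : SineConditions p r c) (h₂ : SineConditions p r (fun j k => c k j)) :
    UniformlyRegularlyConvergent (doubleSineTerm c) := by
  refine ⟨exists_tendstoUniformly_of_eventually_le fun ε hε => ?_,
    fun n hn => h₁.exists_tendstoUniformly_column hp hr hn, fun m hm => ?_⟩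
  · have s₁ := eventually_norm_sum_strip_le hp hr h₁.variation h₂.variation h₁.rowTails h₁.colTails
      (fun l₁ hl₁ l₂ hl₂ => h₁.points.regularlyConvergent hl₁ hl₂)
      (fun ε hε => h₁.eventually_column hp hr le_rfl hε) (half_pos hε)
    have s₂ := eventually_norm_sum_strip_le hp hr h₂.variation h₁.variation h₂.rowTails h₂.colTails
      (fun l₁ hl₁ l₂ hl₂ => h₂.points.regularlyConvergent hl₁ hl₂)
      (fun ε hε => h₂.eventually_column hp hr le_rfl hε) (half_pos hε)
    obtain ⟨K, hK₁, hK₂⟩ := (s₁.and s₂).exists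
    refine ⟨(K, K), fun q hq z => ?_⟩
    have hq1 : K ≤ q.1 := hq.1
    have hq2 : K ≤ q.2 := hq.2
    -- the difference of two rectangles is a union of two strips
    have e : ∑ j ∈ Finset.Icc 1 q.1, ∑ k ∈ Finset.Icc 1 q.2, doubleSineTerm c j k z
          - ∑ j ∈ Finset.Icc 1 K, ∑ k ∈ Finset.Icc 1 K, doubleSineTerm c j k z
        = ∑ j ∈ Finset.Ioc K q.1, ∑ k ∈ Finset.Icc 1 q.2, doubleSineTerm c j k z
          + ∑ k ∈ Finset.Ioc K q.2, ∑ j ∈ Finset.Icc 1 K,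
              doubleSineTerm (fun j k => c k j) k j z.swap := by
      rw [sum_Icc_eq_add_Ioc _ hq1, Finset.sum_comm (s := Finset.Ioc K q.2)]
      simp only [doubleSineTerm_swap]
      rw [Finset.sum_congr rfl fun j (_ : j ∈ Finset.Icc 1 K) =>
        sum_Icc_eq_add_Ioc (fun k => doubleSineTerm c j k z) hq2, Finset.sum_add_distrib]
      ring
    rw [e]
    refine (norm_add_le _ _).trans ?_
    linarith [hK₁ q.1 q.2 z, hK₂ q.2 K z.swap]
  · obtain ⟨S, hS⟩ := h₂.exists_tendstoUniformly_column hp hr hm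
    have e : (fun (N : ℕ) (z : ℝ × ℝ) => ∑ k ∈ Finset.Icc 1 N, doubleSineTerm c m k z)
        = fun N => (fun z => ∑ k ∈ Finset.Icc 1 N,
            doubleSineTerm (fun j k => c k j) k m z) ∘ Prod.swap := by
      funext N z
      exact Finset.sum_congr rfl fun k _ => (doubleSineTerm_swap c m k z).symm
    rw [e]
    exact ⟨S ∘ Prod.swap, hS.comp Prod.swap⟩

theorem mainTheorem1 (p : ℝ) (hp : 1 < p) (r : ℕ) (hr : 1 ≤ r) (c : ℕ → ℕ → ℂ)
    (hc : c ∈ DGMTwo p r)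
    (hpoints : 3 ≤ r →
      ∀ l₁ ∈ Finset.Icc 1 (if Even r then r / 2 - 1 else r / 2),
      ∀ l₂ ∈ Finset.Icc 1 (if Even r then r / 2 - 1 else r / 2),
        RegularlyConvergent (fun j k =>
          doubleSineTerm c j k (2 * (l₁ : ℝ) * Real.pi / r, 2 * (l₂ : ℝ) * Real.pi / r)))
    (htail₁ : Tendsto
      (fun q : ℕ × ℕ => ⨆ (j : ℕ) (_ : q.1 ≤ j),
        ENNReal.ofReal (j * Real.log j) * ∑' i : ℕ, ‖c j (q.2 + i)‖ₑ)
      sumAtTop (𝓝 0))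
    (htail₂ : Tendsto
      (fun q : ℕ × ℕ => ⨆ (k : ℕ) (_ : q.2 ≤ k),
        ENNReal.ofReal (k * Real.log k) * ∑' i : ℕ, ‖c (q.1 + i) k‖ₑ)
      sumAtTop (𝓝 0))
    (hlog : Tendsto
      (fun q : ℕ × ℕ => (q.1 : ℝ) * q.2 * Real.log q.1 * Real.log q.2 * ‖c q.1 q.2‖)
      sumAtTop (𝓝 0)) :
    UniformlyRegularlyConvergent (doubleSineTerm c) := by
  obtain ⟨lam, -, b₁, b₂, b₃, -, hb₁, hb₂, -, hc⟩ := hc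
  obtain ⟨C, hC, lam', hlam', hα, hβ, -⟩ := hc
  have hv₁ : HasColumnVariation p r c := hasColumnVariation_of_dgm hp hC.le hlam' hb₁ hα
  have hv₂ : HasColumnVariation p r (fun j k => c k j) :=
    hasColumnVariation_of_dgm hp hC.le hlam' hb₂ fun m n hm hn => hβ n m hn hm
  have ht₁ : HasLogTails c := hasLogTails_of_tendsto htail₁
  have ht₂ : HasLogTails (fun j k => c k j) :=
    hasLogTails_of_tendsto (by
      simpa only [Function.comp_def, Prod.fst_swap, Prod.snd_swap]
        using htail₂.comp tendsto_swap_sumAtTop)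
  have hpt : ConvergesAtPoints r c := by
    intro h l₁ hl₁ l₂ hl₂
    have h' := hpoints h l₁ hl₁ l₂ hl₂
    simp only [doubleSineTerm] at h'
    exact h'
  exact SineConditions.uniformlyRegularlyConvergent hp hr ⟨hv₁, ht₁, ht₂, hpt⟩
    ⟨hv₂, ht₂, ht₁, hpt.swap⟩
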